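/- **Theorem 1.4.** Let $p$ be a prime number, $q$ a prime power (possibly a power of $p$), $\mathbf F_q$ the field with $q$ elements, and $r\ge 1$ an integer. For a positive integer $m$ write $m_p=p^{\nu_p(m)}$ for its $p$-part, where $\nu_p$ is the $p$-adic valuation, and let $\mathbf Z_p$ be the ring of $p$-adic integers. For $n\ge 1$ let $L_n^*(\mathbf F_q)$ be the poset of subspaces $W$ of $\mathbf F_q^n$ with $0\ne W\ne \mathbf F_q^n$, ordered by inclusion, and for a subgroup $H\le \mathrm{GL}_n(\mathbf F_q)$ let $C_{L_n^*(\mathbf F_q)}(H)$ be the subposet of all $W$ with $gW=W$ for every $g\in H$. For a finite poset $P$ let $\widetilde\chi(P)=\sum_{c}(-1)^{|c|-1}$, the sum over all chains $c$ of $P$ including the empty one, be the reduced Euler characteristic of its order complex (so $\widetilde\chi(\emptyset)=-1$). The $r$-th $p$-primary equivariant reduced Euler characteristic is $$\widetilde\chi{}^p_r(n,q)=\frac1{|\mathrm{GL}_n(\mathbf F_q)|}\sum_{X\in \mathrm{Hom}(\mathbf Z\times\mathbf Z_p^{r-1},\,\mathrm{GL}_n(\mathbf F_q))}\widetilde\chi\bigl(C_{L_n^*(\mathbf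 F_q)}(X(\mathbf Z\times\mathbf Z_p^{r-1}))\bigr),$$ where the (finite) sum runs over all group homomorphisms, and the $r$-th $p$-primary generating function at $q$ is $$F^p_r(x)(q)=1+\sum_{n\ge1}\widetilde\chi{}^p_r(n,q)\,x^n .$$ Then $F^p_r(x)(q)$ has integer coefficients, and, as formal power series over $\mathbf Q$, $$F^p_r(x)(q)=\exp\Bigl(-\sum_{n\ge1}(q^n-1)_p^{\,r-1}\,\frac{x^n}{n}\Bigr).$$ -/

import Mathlib

open scoped MatrixGroups

noncomputable section

namespace PPrimaryEuler

/-- The reduced Euler characteristic of (the order complex of) a finite poset `P`: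
the sum over all finite chains `c` of `P`, the empty one included, of `(-1) ^ (|c| - 1)`,
where a chain with `k + 1` elements is a `k`-simplex.  The exponent is written `|c| + 1`, which has
the same parity. In particular the value at the empty poset is `-1`. -/
def reducedEulerChar (P : Type*) [PartialOrder P] [Finite P] : ℤ :=
  ∑ᶠ c : {c : Finset P // IsChain (· ≤ ·) (c : Set P)}, (-1 : ℤ) ^ (c.1.card + 1)

/-- `L_n(F)^*`: the nonzero proper subspaces of `F ^ n`, ordered by inclusion. -/
abbrev ProperSubspace (F : Type*) [Field F] (n : ℕ) : Type _ :=
  {W : Submodule F (Fin n → F) // W ≠ ⊥ ∧ W ≠ ⊤}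

/-- `C_{L_n(F)^*}(H)`: the nonzero proper subspaces `W` of `F ^ n` with `g W = W`
for all `g` in the subgroup `H` of `GL_n(F)`, ordered by inclusion. -/
abbrev FixedSubspace {F : Type*} [Field F] {n : ℕ} (H : Subgroup (GL (Fin n) F)) : Type _ :=
  {W : ProperSubspace F n //
    ∀ g ∈ H, W.1.map (Matrix.mulVecLin (g : Matrix (Fin n) (Fin n) F)) = W.1}

/-- The additive group `ℤ × ℤ_p ^ (r - 1)`, written multiplicatively. -/
abbrev Source (p : ℕ) [Fact p.Prime] (r : ℕ) : Type :=
  Multiplicative (ℤ × (Fin (r - 1) → ℤ_[p]))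

/-- A homomorphism from `ℤ × ℤ_p ^ (r - 1)` to a finite group is determined by finitely many of
its values, so there are only finitely many of them. -/
instance finite_hom (p : ℕ) [Fact p.Prime] (r : ℕ) (G : Type*) [Group G] [Finite G] :
    Finite (Source p r →* G) := by
  classical
  let φ : (Source p r →* G) → G × (Fin (r - 1) → G) := fun f =>
    (f (.ofAdd (1, 0)), fun i => f (.ofAdd (0, Pi.single i 1)))
  refine Finite.of_injective φ ?_
  intro f g hfg
  have h0 : f (.ofAdd (1, 0)) = g (.ofAdd (1, 0)) := congrArg Prod.fst hfg
  have h1 : ∀ i, f (.ofAdd (0, Pi.single i 1)) = g (.ofAdd (0, Pi.single i 1)) :=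
    fun i => congrFun (congrArg Prod.snd hfg) i
  let E : AddSubgroup (ℤ × (Fin (r - 1) → ℤ_[p])) := Subgroup.toAddSubgroup' (f.eqLocus g)
  have hE : ∀ a, a ∈ E ↔ f (.ofAdd a) = g (.ofAdd a) := fun a => Iff.rfl
  have hN : ∀ a, Nat.card G • a ∈ E := by
    intro a
    rw [hE, ofAdd_nsmul, map_pow, map_pow, pow_card_eq_one', pow_card_eq_one']
  have hcard : ((Nat.card G : ℕ) : ℤ_[p]) ≠ 0 := by
    exact_mod_cast Nat.card_pos.ne'
  have key : ∀ x : ℤ_[p], ∃ (m : ℕ) (y : ℤ_[p]), x = m • (1 : ℤ_[p]) + Nat.card G • y := by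
    intro x
    have hs := PadicInt.appr_spec (PadicInt.valuation ((Nat.card G : ℕ) : ℤ_[p])) x
    obtain ⟨y, hy⟩ := Ideal.mem_span_singleton'.1 hs
    have hu := PadicInt.unitCoeff_spec hcard
    refine ⟨x.appr (PadicInt.valuation ((Nat.card G : ℕ) : ℤ_[p])),
      y * ↑(PadicInt.unitCoeff hcard)⁻¹, ?_⟩
    have : ((Nat.card G : ℕ) : ℤ_[p]) * (y * ↑(PadicInt.unitCoeff hcard)⁻¹)
        = y * (p : ℤ_[p]) ^ (PadicInt.valuation ((Nat.card G : ℕ) : ℤ_[p])) := by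
      conv_lhs =>
        arg 1
        rw [hu]
      rw [mul_comm, mul_assoc, ← mul_assoc (↑(PadicInt.unitCoeff hcard)⁻¹ : ℤ_[p]),
        Units.inv_mul, one_mul]
    rw [nsmul_eq_mul, nsmul_eq_mul, this, hy]
    ring
  have hs : ∀ i x, ((0, Pi.single i x) : ℤ × (Fin (r - 1) → ℤ_[p])) ∈ E := by
    intro i x
    obtain ⟨m, y, rfl⟩ := key x
    have e : ((0, Pi.single i (m • (1 : ℤ_[p]) + Nat.card G • y)) :
        ℤ × (Fin (r - 1) → ℤ_[p])) =
        m • (0, Pi.single i 1) + Nat.card G • (0, Pi.single i y) := by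
      rw [Prod.smul_mk, Prod.smul_mk, Prod.mk_add_mk, ← Pi.single_smul, ← Pi.single_smul,
        ← Pi.single_add]
      simp
    rw [e]
    exact E.add_mem (E.nsmul_mem ((hE _).2 (h1 i)) m) (hN _)
  have hall : ∀ a, a ∈ E := by
    rintro ⟨z, v⟩
    have e : ((z, v) : ℤ × (Fin (r - 1) → ℤ_[p])) =
        z • (1, 0) + ∑ i, ((0, Pi.single i (v i)) : ℤ × (Fin (r - 1) → ℤ_[p])) := by
      refine Prod.ext ?_ ?_
      · simp [Prod.fst_sum]
      · simp [Prod.snd_sum, Finset.univ_sum_single]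
    rw [e]
    exact E.add_mem (E.zsmul_mem ((hE _).2 h0) z) (E.sum_mem fun i _ => hs i _)
  ext a
  exact (hE (Multiplicative.toAdd a)).1 (hall _)

/-- The `r`-th `p`-primary equivariant reduced Euler characteristic of the `GL_n(F)`-poset
`L_n(F)^*`. -/
def primaryEulerChar (p : ℕ) [Fact p.Prime] (F : Type*) [Field F] [Finite F] (r n : ℕ) : ℚ :=
  (Nat.card (GL (Fin n) F) : ℚ)⁻¹ *
    ∑ᶠ X : Source p r →* GL (Fin n) F, (reducedEulerChar (FixedSubspace X.range) : ℚ)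

/-- The `r`-th `p`-primary generating function at `q = |F|`, a power series with constant term `1`
and, a priori, rational coefficients. -/
def primaryGenFun (p : ℕ) [Fact p.Prime] (F : Type*) [Field F] [Finite F] (r : ℕ) :
    PowerSeries ℚ :=
  PowerSeries.mk fun n => if n = 0 then 1 else primaryEulerChar p F r n

/-- The `p`-part `p ^ ν_p(m)` of a positive natural number `m`. -/
def pPart (p m : ℕ) : ℕ := p ^ padicValNat p m

/-- The power series `∑_{n ≥ 1} (q ^ n - 1)_p ^ (r - 1) x ^ n / n`. -/
def primaryExponent (p q r : ℕ) : PowerSeries ℚ :=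
  PowerSeries.mk fun n => if n = 0 then 0 else (pPart p (q ^ n - 1) : ℚ) ^ (r - 1) / (n : ℚ)

end PPrimaryEuler

end

/-! Fix $n$ and put $A=(\mathbf Z/p^N)^{r-1}$ with $N$ large. A homomorphism from $\mathbf
Z\times\mathbf Z_p^{r-1}$ that factors through $\mathbf Z\times A$ is a representation $\rho$ of $A$
on $F^n$ together with an invertible matrix $g$ commuting with it, that is, an $F[A]$-module
structure $V$ on $F^n$ and an automorphism $g$ of $V$. The fixed subspaces are the $g$-invariant
nonzero proper submodules of $V$, so their reduced Euler characteristic is a Möbius number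
$\mu_g(0,V)$. If $p$ is not the characteristic of $F$, every homomorphism factors in this way and
$F[A]$ is semisimple by Maschke. If it is the characteristic, $N=0$ is taken: a homomorphism
nontrivial on $\mathbf Z_p^{r-1}$ has a nontrivial central $p$-subgroup in its image, its fixed
poset is conically contractible, and it contributes $0$.

The heart is the average of $\mu_g(0,V)$ over $g\in\mathrm{Aut}(V)$ for a semisimple $V$
(`weight_stdModule`). Summing the Möbius recursion over all $g$ and counting pairs $(W,g)$ with
$gW=W$ by the isomorphism type of $W$ (`sum_sum_mobiusRestrict`) shows that these averages sum to
$0$ over all types contained in $V\ne0$. This is the recursion of the Möbius function of a product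
of chains, so the average is $\prod_i\mu(t_i)$ in the multiplicities $t_i$ of the simple modules,
with $\mu(0)=1$, $\mu(1)=-1$ and $\mu=0$ beyond.

Dividing by $|\mathrm{GL}_n|$ turns the sum over $\rho$ into a sum over isomorphism classes weighted
by $1/|\mathrm{Aut}|$ (`sum_card_linearEquiv`). Hence the coefficient in degree $n$ is an integer,
namely that of $\prod_i(1-x^{d_i})$, where the $d_i$ are the degrees of the residue fields of
$F[A]$. The logarithm of this product has $-\frac1k\sum_{d_i\mid k}d_i$ as its coefficient of $x^k$,
and $\sum_{d_i\mid k}d_i$ counts the $F$-algebra maps from $F[A]$ to the extension of degree $k$,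
i.e. the characters of $A$ in a cyclic group of order $q^k-1$ (`sum_finrank_quotient`). Since $N$
depends on $n$, the comparison with the exponential is made one coefficient at a time
(`coeff_eq_of_logDerivative`). -/

namespace PPrimaryEuler

/-! ### Reduced Euler characteristics of finite posets -/

section Poset

/-- The finite chains of `P`, the empty one included. -/
abbrev Chains (P : Type*) [PartialOrder P] : Type _ :=
  {c : Finset P // IsChain (· ≤ ·) (c : Set P)}

theorem reducedEulerChar_congr {P Q : Type*} [PartialOrder P] [Finite P] [PartialOrder Q]
    [Finite Q] (e : P ≃o Q) : reducedEulerChar P = reducedEulerChar Q := by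
  classical
  unfold reducedEulerChar
  let E : Chains P ≃ Chains Q :=
    { toFun := fun c => ⟨c.1.map e.toEquiv.toEmbedding, by
        have := c.2.image_of_map_rel (· ≤ ·) (· ≤ ·) e (fun x y h => e.monotone h)
        simpa using this⟩
      invFun := fun c => ⟨c.1.map e.symm.toEquiv.toEmbedding, by
        have := c.2.image_of_map_rel (· ≤ ·) (· ≤ ·) e.symm (fun x y h => e.symm.monotone h)
        simpa using this⟩
      left_inv := fun c => by ext x; simp
      right_inv := fun c => by ext x; simp }
  exact finsum_eq_of_bijective E E.bijective fun c => by simp [E]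

/-- Prepend a top element to a chain strictly below it. -/
noncomputable def consChain {P : Type*} [PartialOrder P] :
    Option (Σ x : P, Chains {y : P // y < x}) → Chains P := by
  classical
  exact fun o => match o with
  | none => ⟨∅, by simp⟩
  | some ⟨x, c⟩ => ⟨insert x (c.1.map (Function.Embedding.subtype _)), by
      have h1 := c.2.image_of_map_rel (· ≤ ·) (· ≤ ·) (Subtype.val : {y : P // y < x} → P)
        (fun x y h => h)
      rw [Finset.coe_insert]
      refine IsChain.insert (by simpa using h1) ?_
      intro b hb _
      right
      simp only [Finset.coe_map, Function.Embedding.subtype_apply, Set.mem_image] at hb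
      obtain ⟨y, -, rfl⟩ := hb
      exact y.2.le⟩

theorem consChain_bijective {P : Type*} [PartialOrder P] :
    Function.Bijective (consChain (P := P)) := by
  classical
  constructor
  · rintro (_ | ⟨x, c⟩) (_ | ⟨y, d⟩) h
    · rfl
    · simp [consChain, Subtype.ext_iff] at h
      exact absurd h.symm (Finset.insert_ne_empty _ _)
    · simp [consChain, Subtype.ext_iff] at h
    · have h' : insert x (c.1.map (Function.Embedding.subtype _)) =
          insert y (d.1.map (Function.Embedding.subtype _)) := congrArg Subtype.val h
      have hx : x ≤ y := by
        have : x ∈ insert y (d.1.map (Function.Embedding.subtype _)) := by simp [← h']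
        rcases Finset.mem_insert.1 this with h | h
        · exact h.le
        · obtain ⟨z, -, rfl⟩ := Finset.mem_map.1 h
          exact z.2.le
      have hy : y ≤ x := by
        have : y ∈ insert x (c.1.map (Function.Embedding.subtype _)) := by simp [h']
        rcases Finset.mem_insert.1 this with h | h
        · exact h.le
        · obtain ⟨z, -, rfl⟩ := Finset.mem_map.1 h
          exact z.2.le
      obtain rfl := le_antisymm hx hy
      have hc : ∀ e : Finset {y : P // y < x}, x ∉ e.map (Function.Embedding.subtype _) := by
        intro e he
        obtain ⟨z, -, hz⟩ := Finset.mem_map.1 he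
        exact absurd z.2 (by simp at hz; simp [hz])
      have h2 := congrArg (fun s => Finset.erase s x) h'
      simp only [Finset.erase_insert (hc _)] at h2
      have h3 : c = d := Subtype.ext (Finset.map_injective _ h2)
      rw [h3]
  · rintro ⟨c, hc⟩
    rcases c.eq_empty_or_nonempty with rfl | hne
    · exact ⟨none, rfl⟩
    · obtain ⟨x, hx, hmax⟩ := c.exists_maximal hne
      have hlt : ∀ y ∈ c, y ≠ x → y < x := fun y hy hyx =>
        lt_of_le_of_ne ((hc hy hx hyx).elim id fun h => hmax hy h) hyx
      refine ⟨some ⟨x, ⟨c.subtype (· < x), ?_⟩⟩, ?_⟩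
      · intro a ha b hb hab
        exact hc (Finset.mem_subtype.1 ha) (Finset.mem_subtype.1 hb)
          (fun h => hab (Subtype.ext h))
      · apply Subtype.ext
        ext y
        simp only [consChain, Finset.mem_insert, Finset.mem_map, Finset.mem_subtype,
          Function.Embedding.subtype_apply, Subtype.exists, exists_and_left, exists_prop,
          exists_eq_right_right]
        constructor
        · rintro (rfl | h)
          · exact hx
          · exact h.1
        · intro hy
          by_cases hyx : y = x
          · exact Or.inl hyx
          · exact Or.inr ⟨hy, hlt y hy hyx⟩

/-- Nonempty chains are sorted by their largest element; removing it reverses the sign. The empty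
chain contributes $-1$. -/
theorem reducedEulerChar_eq_sum {P : Type*} [PartialOrder P] [Finite P] [Fintype P] :
    reducedEulerChar P = -1 - ∑ x : P, reducedEulerChar {y : P // y < x} := by
  classical
  have hF : ∀ (Q : Type _) [PartialOrder Q] [Finite Q] [Fintype Q], reducedEulerChar Q =
      ∑ c : Chains Q, (-1 : ℤ) ^ (c.1.card + 1) := fun Q _ _ _ => finsum_eq_sum_of_fintype _
  rw [hF P, ← Fintype.sum_bijective _ consChain_bijective _ _ (fun _ => rfl), Fintype.sum_option,
    Fintype.sum_sigma]
  simp only [hF {y : P // _ < _}]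
  have : ∀ (x : P) (c : Chains {y : P // y < x}), (consChain (some ⟨x, c⟩)).1.card =
      c.1.card + 1 := by
    intro x c
    have hx : x ∉ c.1.map (Function.Embedding.subtype _) := by
      intro he
      obtain ⟨z, -, hz⟩ := Finset.mem_map.1 he
      exact absurd z.2 (by simp at hz; simp [hz])
    simp [consChain, Finset.card_insert_of_notMem hx]
  simp only [this]
  simp [consChain, pow_succ, Finset.sum_neg_distrib]

/-- In the recursion, the term of the top `a` is expanded once more by the recursion for the
elements below `a`, and it cancels everything else. -/
theorem reducedEulerChar_eq_zero_of_isTop {P : Type*} [PartialOrder P] [Finite P] (a : P)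
    (ha : ∀ x, x ≤ a) : reducedEulerChar P = 0 := by
  classical
  have := Fintype.ofFinite P
  have h1 := reducedEulerChar_eq_sum (P := P)
  have h2 := reducedEulerChar_eq_sum (P := {x : P // x < a})
  rw [← Finset.add_sum_erase _ _ (Finset.mem_univ a), h2] at h1
  rw [h1]
  have h3 : ∑ x ∈ Finset.univ.erase a, reducedEulerChar {y : P // y < x} =
      ∑ x : {x : P // x < a}, reducedEulerChar {y : {x : P // x < a} // y < x} := by
    rw [Finset.sum_subtype (Finset.univ.erase a) (p := fun x => x < a)
      (by intro x; simp [lt_iff_le_and_ne, ha x])]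
    refine Finset.sum_congr rfl fun x _ => reducedEulerChar_congr
      { toFun := fun y => ⟨⟨y.1, y.2.trans x.2⟩, y.2⟩
        invFun := fun y => ⟨y.1.1, y.2⟩
        left_inv := fun _ => rfl
        right_inv := fun _ => rfl
        map_rel_iff' := Iff.rfl }
  rw [h3]
  ring

/-- A finite poset with a decreasing monotone self-map whose image is bounded above by a single
element is conically contractible, so that its reduced Euler characteristic vanishes. -/
theorem reducedEulerChar_eq_zero_of_conical {P : Type*} [PartialOrder P] [Finite P] (f : P → P)
    (hf : Monotone f) (hle : ∀ x, f x ≤ x) (a : P) (ha : ∀ x, f x ≤ a) :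
    reducedEulerChar P = 0 := by
  classical
  induction hn : Nat.card P using Nat.strong_induction_on generalizing P with
  | _ n ih =>
  have := Fintype.ofFinite P
  -- Below such an `x` the same map `f` is again a contraction, now with apex `f x`, which is
  -- strictly below `x` because `f x = x` would force `x ≤ a`. So the recursion sees only the `x ≤
  -- a`, exactly as for the cone `{x // x ≤ a}`.
  have hzero : ∀ x : P, ¬ x ≤ a → reducedEulerChar {y : P // y < x} = 0 := by
    intro x hx
    have hfx : f x < x := lt_of_le_of_ne (hle x) fun h => hx (h ▸ ha x)
    refine ih _ ?_ (P := {y : P // y < x}) (fun y => ⟨f y.1, (hle _).trans_lt y.2⟩)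
      (fun y z h => hf h) (fun y => hle _) ⟨f x, hfx⟩ (fun y => hf y.2.le) rfl
    rw [← hn]
    exact Finite.card_subtype_lt (x := x) (lt_irrefl x)
  rw [reducedEulerChar_eq_sum, ← reducedEulerChar_eq_zero_of_isTop (P := {x : P // x ≤ a})
    ⟨a, le_rfl⟩ (fun x => x.2), reducedEulerChar_eq_sum (P := {x : P // x ≤ a})]
  congr 1
  rw [← Finset.sum_filter_add_sum_filter_not Finset.univ (fun x : P => x ≤ a),
    Finset.sum_eq_zero (s := Finset.univ.filter fun x : P => ¬ x ≤ a)
      (fun x hx => hzero x (Finset.mem_filter.1 hx).2), add_zero,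
    Finset.sum_subtype (Finset.univ.filter fun x : P => x ≤ a) (p := fun x => x ≤ a) (by simp)]
  refine Finset.sum_congr rfl fun x _ => reducedEulerChar_congr
    { toFun := fun y => ⟨⟨y.1, y.2.le.trans x.2⟩, y.2⟩
      invFun := fun y => ⟨y.1.1, y.2⟩
      left_inv := fun _ => rfl
      right_inv := fun _ => rfl
      map_rel_iff' := Iff.rfl }

end Poset

/-! ### Möbius numbers of lattices of invariant submodules -/

section Mobius

variable {R : Type*} [Ring R] {V : Type*} [AddCommGroup V] [Module R V]
  {V' : Type*} [AddCommGroup V'] [Module R V']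

/-- The nonzero proper submodules invariant under the endomorphism `φ`. -/
abbrev InvariantProper (φ : Module.End R V) : Type _ :=
  {W : Submodule R V // (W ≠ ⊥ ∧ W ≠ ⊤) ∧ W ≤ W.comap φ}

open Classical in
/-- The Möbius number `μ(0, V)` of the lattice of `φ`-invariant submodules of `V`. -/
noncomputable def mobius [Finite V] (φ : Module.End R V) : ℤ :=
  if Subsingleton V then 1 else reducedEulerChar (InvariantProper φ)

theorem mobius_of_subsingleton [Finite V] [Subsingleton V] (φ : Module.End R V) :
    mobius φ = 1 := if_pos ‹_›

theorem mobius_of_nontrivial [Finite V] [Nontrivial V] (φ : Module.End R V) :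
    mobius φ = reducedEulerChar (InvariantProper φ) :=
  if_neg (not_subsingleton V)

/-- Conjugate endomorphisms have isomorphic posets of invariant submodules. -/
def InvariantProper.congr (e : V ≃ₗ[R] V') {φ : Module.End R V} {φ' : Module.End R V'}
    (h : ∀ v, e (φ v) = φ' (e v)) : InvariantProper φ ≃o InvariantProper φ' where
  toFun W := ⟨Submodule.orderIsoMapComap e W.1, by
    refine ⟨⟨?_, ?_⟩, ?_⟩
    · simpa using W.2.1.1
    · simpa using W.2.1.2
    · rintro _ ⟨v, hv, rfl⟩
      exact ⟨φ v, W.2.2 hv, h v⟩⟩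
  invFun W := ⟨(Submodule.orderIsoMapComap e).symm W.1, by
    refine ⟨⟨?_, ?_⟩, ?_⟩
    · exact (map_eq_bot_iff (Submodule.orderIsoMapComap e).symm).not.2 W.2.1.1
    · exact (map_eq_top_iff (Submodule.orderIsoMapComap e).symm).not.2 W.2.1.2
    · intro v hv
      have : φ' (e v) ∈ W.1 := W.2.2 hv
      rw [← h] at this
      exact this⟩
  left_inv W := Subtype.ext ((Submodule.orderIsoMapComap e).left_inv W.1)
  right_inv W := Subtype.ext ((Submodule.orderIsoMapComap e).right_inv W.1)
  map_rel_iff' := (Submodule.orderIsoMapComap e).map_rel_iff'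

theorem mobius_congr [Finite V] [Finite V'] (e : V ≃ₗ[R] V') {φ : Module.End R V}
    {φ' : Module.End R V'} (h : ∀ v, e (φ v) = φ' (e v)) : mobius φ = mobius φ' := by
  rcases subsingleton_or_nontrivial V with hV | hV
  · have := e.symm.injective.subsingleton
    rw [mobius_of_subsingleton, mobius_of_subsingleton]
  · have := e.symm.surjective.nontrivial
    rw [mobius_of_nontrivial, mobius_of_nontrivial]
    exact reducedEulerChar_congr (InvariantProper.congr e h)

open Classical in
/-- The Möbius number of an invariant submodule, and `0` for the other submodules. -/
noncomputable def mobiusRestrict [Finite V] (φ : Module.End R V) (W : Submodule R V) : ℤ :=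
  if h : W ≤ W.comap φ then mobius (φ.restrict h) else 0

/-- The invariant submodules strictly below an invariant submodule `W` are those of `W`. -/
def InvariantProper.iioEquiv {φ : Module.End R V} (W : InvariantProper φ) :
    InvariantProper (φ.restrict W.2.2) ≃o {U : InvariantProper φ // U < W} where
  toFun U := ⟨⟨U.1.map W.1.subtype, by
      refine ⟨⟨?_, ?_⟩, ?_⟩
      · exact fun h => U.2.1.1 (Submodule.map_injective_of_injective W.1.injective_subtype
          (h.trans (Submodule.map_bot _).symm))
      · intro h
        exact W.2.1.2 (top_le_iff.1 (h.symm.le.trans (Submodule.map_subtype_le _ _)))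
      · rintro _ ⟨v, hv, rfl⟩
        exact ⟨_, U.2.2 hv, rfl⟩⟩, by
      refine lt_of_le_of_ne (Submodule.map_subtype_le _ _) fun h => U.2.1.2 ?_
      have h' : U.1.map W.1.subtype = W.1 := congrArg Subtype.val h
      rw [eq_top_iff]
      intro v _
      have hv : (v : V) ∈ U.1.map W.1.subtype := h'.symm ▸ v.2
      obtain ⟨u, hu, huv⟩ := hv
      rwa [← Subtype.ext (a1 := u) (a2 := v) huv]⟩
  invFun U := ⟨U.1.1.comap W.1.subtype, by
    have hUW : U.1.1 ≤ W.1 := U.2.le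
    refine ⟨⟨?_, ?_⟩, ?_⟩
    · intro h
      refine U.1.2.1.1 ((Submodule.eq_bot_iff _).2 fun v hv => ?_)
      have : (⟨v, hUW hv⟩ : W.1) ∈ U.1.1.comap W.1.subtype := hv
      rw [h, Submodule.mem_bot] at this
      exact congrArg Subtype.val this
    · intro h
      refine U.2.not_ge fun v hv => ?_
      have : (⟨v, hv⟩ : W.1) ∈ U.1.1.comap W.1.subtype := h ▸ Submodule.mem_top
      exact this
    · intro v hv
      exact U.1.2.2 hv⟩
  left_inv U := Subtype.ext (Submodule.comap_map_eq_of_injective W.1.injective_subtype _)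
  right_inv U := Subtype.ext (Subtype.ext (by
    have hUW : U.1.1 ≤ W.1 := U.2.le
    simpa [Submodule.map_comap_subtype] using hUW))
  map_rel_iff' := by
    intro U U'
    exact Submodule.map_le_map_iff_of_injective W.1.injective_subtype _ _

/-- The recursion for the reduced Euler characteristic in Möbius form: `⊥` gives $1$ by the
convention for the zero module, `⊤` gives the Euler characteristic itself, and the invariant
submodules in between give the remaining terms. -/
theorem sum_mobiusRestrict [Finite V] [Nontrivial V] [Fintype (Submodule R V)]
    (φ : Module.End R V) : ∑ W : Submodule R V, mobiusRestrict φ W = 0 := by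
  classical
  have := Fintype.ofFinite (InvariantProper φ)
  have hbot : mobiusRestrict φ ⊥ = 1 := by
    rw [mobiusRestrict, dif_pos (by simp), mobius_of_subsingleton]
  have htop : mobiusRestrict φ ⊤ = reducedEulerChar (InvariantProper φ) := by
    rw [mobiusRestrict, dif_pos (by simp), ← mobius_of_nontrivial]
    exact mobius_congr Submodule.topEquiv (fun _ => rfl)
  have hmid : ∑ W ∈ (Finset.univ.erase (⊤ : Submodule R V)).erase ⊥, mobiusRestrict φ W =
      ∑ W : InvariantProper φ, reducedEulerChar {U : InvariantProper φ // U < W} := by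
    have h0 : ∀ W ∈ (Finset.univ.erase (⊤ : Submodule R V)).erase ⊥, mobiusRestrict φ W ≠ 0 →
        W ≤ W.comap φ := by
      intro W _ h
      by_contra hW
      exact h (dif_neg hW)
    rw [← Finset.sum_filter_of_ne h0, Finset.sum_subtype _
      (p := fun W => (W ≠ ⊥ ∧ W ≠ ⊤) ∧ W ≤ W.comap φ) (by intro W; simp)]
    refine Finset.sum_congr rfl fun W _ => ?_
    have : Nontrivial W.1 := Submodule.nontrivial_iff_ne_bot.2 W.2.1.1
    rw [mobiusRestrict, dif_pos W.2.2, mobius_of_nontrivial]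
    exact reducedEulerChar_congr (InvariantProper.iioEquiv W)
  rw [← Finset.add_sum_erase _ _ (Finset.mem_univ (⊤ : Submodule R V)),
    ← Finset.add_sum_erase _ _ (Finset.mem_erase.2 ⟨bot_ne_top, Finset.mem_univ _⟩), hmid, hbot,
    htop, reducedEulerChar_eq_sum]
  ring

end Mobius

/-! ### Finite modules over a finite commutative semisimple ring -/

section StdModule

variable {R : Type*} [CommRing R]
  {V : Type*} [AddCommGroup V] [Module R V] {V' : Type*} [AddCommGroup V'] [Module R V']

instance finite_linearMap [Finite V] [Finite V'] : Finite (V →ₗ[R] V') := DFunLike.finite _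

instance finite_linearEquiv [Finite V] [Finite V'] : Finite (V ≃ₗ[R] V') := DFunLike.finite _

instance finite_quotient [Finite R] (I : Ideal R) : Finite (R ⧸ I) :=
  Finite.of_surjective _ (Ideal.Quotient.mk_surjective (I := I))

/-- The semisimple module in which the simple module `R ⧸ i` has multiplicity `t i`. -/
abbrev StdModule (t : MaximalSpectrum R → ℕ) : Type _ :=
  (i : MaximalSpectrum R) → Fin (t i) → R ⧸ i.asIdeal

/-- Each simple summand is a quotient by a maximal ideal; the summands are regrouped by that ideal.
-/
theorem exists_linearEquiv_stdModule [Finite R] [IsSemisimpleRing R] [Finite V] :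
    ∃ t : MaximalSpectrum R → ℕ, Nonempty (V ≃ₗ[R] StdModule t) := by
  classical
  obtain ⟨n, S, e, hS⟩ := IsSemisimpleModule.exists_linearEquiv_fin_dfinsupp R V
  have hq := fun j => isSimpleModule_iff_quot_maximal.1 (hS j)
  choose I hI hIe using hq
  let k : Fin n → MaximalSpectrum R := fun j => ⟨I j, hI j⟩
  let t : MaximalSpectrum R → ℕ := fun i => Nat.card {j // k j = i}
  let σ : (Σ i, Fin (t i)) ≃ Fin n :=
    (Equiv.sigmaCongrRight fun i => (Finite.equivFin {j // k j = i}).symm).trans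
      (Equiv.sigmaFiberEquiv k)
  have hσ : ∀ x, I (σ x) = x.1.asIdeal := fun x => by
    have : k (σ x) = x.1 := ((Finite.equivFin {j // k j = x.1}).symm x.2).2
    rw [← this]
  let e1 : V ≃ₗ[R] ((j : Fin n) → R ⧸ I j) :=
    e.trans ((DFinsupp.linearEquivFunOnFintype).trans
      (LinearEquiv.piCongrRight fun j => (hIe j).some))
  let e2 : ((j : Fin n) → R ⧸ I j) ≃ₗ[R] ((x : Σ i, Fin (t i)) → R ⧸ x.1.asIdeal) :=
    (LinearEquiv.piCongrLeft R (fun j => R ⧸ I j) σ).symm.trans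
      (LinearEquiv.piCongrRight fun x => Submodule.quotEquivOfEq _ _ (hσ x))
  let e3 : ((x : Σ i, Fin (t i)) → R ⧸ x.1.asIdeal) ≃ₗ[R] StdModule t :=
    { Equiv.piCurry (fun (i : MaximalSpectrum R) (_ : Fin (t i)) => R ⧸ i.asIdeal) with
      map_add' := fun _ _ => rfl
      map_smul' := fun _ _ => rfl }
  exact ⟨t, ⟨e1.trans (e2.trans e3)⟩⟩

variable (V) in
/-- The number of elements of `V` annihilated by the maximal ideal `i`. -/
noncomputable def torsionCard (i : MaximalSpectrum R) : ℕ :=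
  Nat.card {v : V // ∀ a ∈ i.asIdeal, a • v = 0}

theorem torsionCard_congr (e : V ≃ₗ[R] V') (i : MaximalSpectrum R) :
    torsionCard V i = torsionCard V' i :=
  Nat.card_congr (e.toEquiv.subtypeEquiv fun v => by
    refine forall₂_congr fun a _ => ?_
    change _ ↔ a • e v = 0
    rw [← map_smul, e.map_eq_zero_iff])

theorem torsionCard_le_of_injective [Finite V'] (f : V →ₗ[R] V') (hf : Function.Injective f)
    (i : MaximalSpectrum R) : torsionCard V i ≤ torsionCard V' i :=
  Nat.card_le_card_of_injective
    (fun v => (⟨f v.1, fun a ha => by rw [← map_smul, v.2 a ha, map_zero]⟩ :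
      {v : V' // ∀ a ∈ i.asIdeal, a • v = 0}))
    (fun v w h => Subtype.ext (hf (congrArg Subtype.val h)))

theorem torsionCard_prod (i : MaximalSpectrum R) :
    torsionCard (V × V') i = torsionCard V i * torsionCard V' i := by
  rw [torsionCard, torsionCard, torsionCard, ← Nat.card_prod]
  exact Nat.card_congr
    { toFun := fun v => (⟨v.1.1, fun a ha => congrArg Prod.fst (v.2 a ha)⟩,
        ⟨v.1.2, fun a ha => congrArg Prod.snd (v.2 a ha)⟩)
      invFun := fun v => ⟨(v.1.1, v.2.1), fun a ha => Prod.ext (v.1.2 a ha) (v.2.2 a ha)⟩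
      left_inv := fun _ => rfl
      right_inv := fun _ => rfl }

/-- The part killed by `i` is exactly the block at `i`: an entry in a block `k ≠ i` would be killed
by two comaximal ideals. Thus torsion counts recover the multiplicities. -/
theorem torsionCard_stdModule (t : MaximalSpectrum R → ℕ) (i : MaximalSpectrum R) :
    torsionCard (StdModule t) i = Nat.card (R ⧸ i.asIdeal) ^ t i := by
  classical
  have hrhs : Nat.card (R ⧸ i.asIdeal) ^ t i = Nat.card (Fin (t i) → R ⧸ i.asIdeal) := by
    simp [Nat.card_pi]
  rw [hrhs]
  refine Nat.card_congr (Equiv.ofBijective (fun v => v.1 i) ⟨?_, ?_⟩)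
  · rintro ⟨v, hv⟩ ⟨w, hw⟩ (h : v i = w i)
    have key : ∀ u : StdModule t, (∀ a ∈ i.asIdeal, a • u = 0) → ∀ k, k ≠ i → u k = 0 := by
      intro u hu k hk
      have hne : i.asIdeal ≠ k.asIdeal := fun h => hk (MaximalSpectrum.ext h.symm)
      have hsup := Ideal.isCoprime_of_isMaximal (I := i.asIdeal) (J := k.asIdeal) hne
      obtain ⟨a, ha, b, hb, hab⟩ := Ideal.isCoprime_iff_exists.1 hsup
      funext j
      have h1 : a • u k j = 0 := congrFun (congrFun (hu a ha) k) j
      have h2 : b • u k j = 0 := by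
        obtain ⟨x, hx⟩ := Ideal.Quotient.mk_surjective (u k j)
        rw [← hx, ← Ideal.Quotient.mk_eq_mk, ← Submodule.Quotient.mk_smul,
          Submodule.Quotient.mk_eq_zero]
        exact Ideal.mul_mem_right _ _ hb
      rw [← one_smul R (u k j), ← hab, add_smul, h1, h2, add_zero]
      rfl
    apply Subtype.ext
    funext k
    by_cases hk : k = i
    · subst hk
      exact h
    · exact (key v hv k hk).trans (key w hw k hk).symm
  · intro w
    refine ⟨⟨(Pi.single i w : StdModule t), fun a ha => ?_⟩, by simp⟩
    rw [← Pi.single_smul]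
    have : a • w = 0 := by
      funext j
      obtain ⟨x, hx⟩ := Ideal.Quotient.mk_surjective (w j)
      change a • w j = 0
      rw [← hx, ← Ideal.Quotient.mk_eq_mk, ← Submodule.Quotient.mk_smul,
        Submodule.Quotient.mk_eq_zero]
      exact Ideal.mul_mem_right _ _ ha
    rw [this, Pi.single_zero]

theorem exists_injective_stdModule {t t' : MaximalSpectrum R → ℕ} (h : t ≤ t') :
    ∃ f : StdModule t →ₗ[R] StdModule t', Function.Injective f := by
  classical
  refine ⟨LinearMap.pi fun i => (LinearMap.pi fun j : Fin (t' i) =>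
    if hj : (j : ℕ) < t i then LinearMap.proj (⟨j, hj⟩ : Fin (t i)) else 0) ∘ₗ
      LinearMap.proj i, ?_⟩
  intro v w hvw
  funext i j
  have := congrFun (congrFun hvw i) ⟨j, j.2.trans_le (h i)⟩
  simpa using this

variable [Finite R]

theorem one_lt_card_quotient (i : MaximalSpectrum R) : 1 < Nat.card (R ⧸ i.asIdeal) := by
  have := Ideal.Quotient.nontrivial_iff.2 i.isMaximal.ne_top
  exact Finite.one_lt_card

theorem stdModule_injective {t t' : MaximalSpectrum R → ℕ}
    (e : StdModule t ≃ₗ[R] StdModule t') : t = t' := by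
  funext i
  have := torsionCard_congr e i
  rw [torsionCard_stdModule, torsionCard_stdModule] at this
  exact Nat.pow_right_injective (one_lt_card_quotient i) this

variable [IsSemisimpleRing R]

theorem nonempty_linearEquiv_of_torsionCard_eq [Finite V] [Finite V']
    (h : ∀ i : MaximalSpectrum R, torsionCard V i = torsionCard V' i) :
    Nonempty (V ≃ₗ[R] V') := by
  obtain ⟨t, ⟨e⟩⟩ := exists_linearEquiv_stdModule (R := R) (V := V)
  obtain ⟨t', ⟨e'⟩⟩ := exists_linearEquiv_stdModule (R := R) (V := V')
  have : t = t' := by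
    funext i
    have := h i
    rw [torsionCard_congr e, torsionCard_congr e', torsionCard_stdModule,
      torsionCard_stdModule] at this
    exact Nat.pow_right_injective (one_lt_card_quotient i) this
  subst this
  exact ⟨e.trans e'.symm⟩

theorem le_of_injective_stdModule {t t' : MaximalSpectrum R → ℕ}
    (f : StdModule t →ₗ[R] StdModule t') (hf : Function.Injective f) : t ≤ t' := by
  intro i
  have := torsionCard_le_of_injective f hf i
  rw [torsionCard_stdModule, torsionCard_stdModule] at this
  exact (Nat.pow_le_pow_iff_right (one_lt_card_quotient i)).1 this

/-- Two embeddings into a finite semisimple module differ by an automorphism. -/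
theorem exists_linearEquiv_comp_eq {U : Type*} [AddCommGroup U] [Module R U] [Finite V]
    (j j' : U →ₗ[R] V) (hj : Function.Injective j) (hj' : Function.Injective j') :
    ∃ g : V ≃ₗ[R] V, ∀ u, g (j u) = j' u := by
  have : Finite U := Finite.of_injective _ hj
  obtain ⟨C, hC⟩ := exists_isCompl (LinearMap.range j)
  obtain ⟨C', hC'⟩ := exists_isCompl (LinearMap.range j')
  let e : (U × C) ≃ₗ[R] V := ((LinearEquiv.ofInjective j hj).prodCongr (.refl R C)).trans
    (Submodule.prodEquivOfIsCompl _ _ hC)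
  let e' : (U × C') ≃ₗ[R] V := ((LinearEquiv.ofInjective j' hj').prodCongr (.refl R C')).trans
    (Submodule.prodEquivOfIsCompl _ _ hC')
  -- Cancellation: torsion counts are multiplicative on products and positive, so `U × C ≃ U × C'`
  -- forces equal counts, hence an isomorphism, for the complements.
  obtain ⟨f⟩ : Nonempty (C ≃ₗ[R] C') := by
    refine nonempty_linearEquiv_of_torsionCard_eq fun i => ?_
    have h := torsionCard_congr (e.trans e'.symm) i
    rw [torsionCard_prod, torsionCard_prod] at h
    have hpos : 0 < torsionCard U i :=
      Nat.card_pos_iff.2 ⟨⟨⟨0, fun a _ => smul_zero a⟩⟩, inferInstance⟩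
    exact Nat.eq_of_mul_eq_mul_left hpos h
  refine ⟨e.symm.trans (((LinearEquiv.refl R U).prodCongr f).trans e'), fun u => ?_⟩
  have h1 : e (u, 0) = j u := by simp [e]
  have h2 : e' (u, 0) = j' u := by simp [e']
  rw [← h1, ← h2]
  simp

end StdModule

/-! ### The average Möbius number over the automorphism group -/

section Weight

/-- The average of the Möbius numbers `μ(0, V)` over the automorphisms of `V`. -/
noncomputable def weight (R : Type*) [CommRing R] (V : Type*) [AddCommGroup V] [Module R V]
    [Finite V] : ℚ :=
  (Nat.card (V ≃ₗ[R] V) : ℚ)⁻¹ * ∑ᶠ h : V ≃ₗ[R] V, (mobius (h : V →ₗ[R] V) : ℚ)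

variable {R : Type*} [CommRing R] {U : Type*} [AddCommGroup U] [Module R U]
  {V : Type*} [AddCommGroup V] [Module R V]

theorem sum_mobius_eq [Finite V] [Fintype (V ≃ₗ[R] V)] :
    ∑ h : V ≃ₗ[R] V, (mobius (h : V →ₗ[R] V) : ℚ) = Nat.card (V ≃ₗ[R] V) * weight R V := by
  have : (Nat.card (V ≃ₗ[R] V) : ℚ) ≠ 0 := Nat.cast_ne_zero.2 Nat.card_pos.ne'
  rw [weight, finsum_eq_sum_of_fintype, mul_inv_cancel_left₀ this]

theorem weight_congr [Finite U] [Finite V] (e : U ≃ₗ[R] V) : weight R U = weight R V := by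
  let E : (U ≃ₗ[R] U) ≃ (V ≃ₗ[R] V) :=
    { toFun := fun h => e.symm.trans (h.trans e)
      invFun := fun h => e.trans (h.trans e.symm)
      left_inv := fun h => by ext; simp
      right_inv := fun h => by ext; simp }
  rw [weight, weight, Nat.card_congr E]
  congr 1
  refine finsum_eq_of_bijective E E.bijective fun h => ?_
  rw [mobius_congr e]
  intro v
  simp [E]

theorem weight_of_subsingleton [Finite V] [Subsingleton V] : weight R V = 1 := by
  have : Fintype (V ≃ₗ[R] V) := Fintype.ofFinite _
  have hs : Subsingleton (V ≃ₗ[R] V) := ⟨fun f g => LinearEquiv.ext fun v => Subsingleton.elim _ _⟩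
  have hc : Nat.card (V ≃ₗ[R] V) = 1 :=
    Nat.card_eq_one_iff_unique.2 ⟨hs, ⟨LinearEquiv.refl R V⟩⟩
  have h := sum_mobius_eq (R := R) (V := V)
  simp only [mobius_of_subsingleton, hc] at h
  rw [Finset.sum_const, Finset.card_univ, ← Nat.card_eq_fintype_card, hc] at h
  simpa using h.symm

variable [Finite R] [IsSemisimpleRing R] [Finite V]

/-- Automorphisms act transitively on embeddings of `U`, so each transporter is in bijection with
the stabilizer of `j₀`. -/
theorem card_linearEquiv_comp_eq {j₀ : U →ₗ[R] V} (hj₀ : Function.Injective j₀)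
    (j j' : U →ₗ[R] V) (hj : Function.Injective j) (hj' : Function.Injective j') :
    Nat.card {g : V ≃ₗ[R] V // ∀ u, g (j u) = j' u} =
      Nat.card {g : V ≃ₗ[R] V // ∀ u, g (j₀ u) = j₀ u} := by
  obtain ⟨α, hα⟩ := exists_linearEquiv_comp_eq j₀ j hj₀ hj
  obtain ⟨β, hβ⟩ := exists_linearEquiv_comp_eq j₀ j' hj₀ hj'
  refine Nat.card_congr
    { toFun := fun g => ⟨α.trans (g.1.trans β.symm), fun u => ?_⟩
      invFun := fun g => ⟨α.symm.trans (g.1.trans β), fun u => ?_⟩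
      left_inv := fun g => by ext; simp
      right_inv := fun g => by ext; simp }
  · simp [hα, g.2, ← hβ]
  · simp [← hα, g.2, hβ]

/-- Let `κ` be the order of the stabilizer of an embedding. For each `W ≅ U`, every automorphism of
`U` is induced on `W` by exactly `κ` automorphisms of `V`, while counting embeddings gives
$|\mathrm{Aut}\,V|=\kappa\cdot\#\{W\}\cdot|\mathrm{Aut}\,U|$. In the product `κ` and the number of
`W` disappear. -/
theorem sum_sum_mobiusRestrict [Fintype (Submodule R V)] [Fintype (V ≃ₗ[R] V)] [Finite U]
    [DecidablePred fun W : Submodule R V => Nonempty (U ≃ₗ[R] W)]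
    {j₀ : U →ₗ[R] V} (hj₀ : Function.Injective j₀) :
    ∑ W ∈ Finset.univ.filter fun W : Submodule R V => Nonempty (U ≃ₗ[R] W),
      ∑ g : V ≃ₗ[R] V, (mobiusRestrict (g : V →ₗ[R] V) W : ℚ) =
        Nat.card (V ≃ₗ[R] V) * weight R U := by
  classical
  have : Fintype (U ≃ₗ[R] U) := Fintype.ofFinite _
  set κ := Nat.card {g : V ≃ₗ[R] V // ∀ u, g (j₀ u) = j₀ u} with hκ
  have hcount : ∀ j j' : U →ₗ[R] V, Function.Injective j → Function.Injective j' →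
      (∑ g : V ≃ₗ[R] V, if ∀ u, g (j u) = j' u then (1 : ℚ) else 0) = κ := by
    intro j j' hj hj'
    rw [hκ, ← card_linearEquiv_comp_eq hj₀ j j' hj hj', Finset.sum_boole,
      Nat.card_eq_fintype_card, Fintype.card_subtype]
  let 𝒲 := {W : Submodule R V // Nonempty (U ≃ₗ[R] W)}
  let e : ∀ W : 𝒲, U ≃ₗ[R] W.1 := fun W => W.2.some
  let ι : ∀ W : 𝒲, (U ≃ₗ[R] U) → U →ₗ[R] V := fun W h =>
    W.1.subtype ∘ₗ (e W : U →ₗ[R] W.1) ∘ₗ (h : U →ₗ[R] U)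
  have hι : ∀ W h, Function.Injective (ι W h) := fun W h =>
    W.1.injective_subtype.comp ((e W).injective.comp h.injective)
  have hsum : ∀ W : 𝒲, ∑ g : V ≃ₗ[R] V, (mobiusRestrict (g : V →ₗ[R] V) W.1 : ℚ) =
      κ * ∑ h : U ≃ₗ[R] U, (mobius (h : U →ₗ[R] U) : ℚ) := by
    intro W
    -- At most one `h` matches `g`: its restriction to `W`, carried to `U`. There is none when `g`
    -- does not preserve `W`, where `mobiusRestrict` is $0$.
    have h1 : ∀ g : V ≃ₗ[R] V, (mobiusRestrict (g : V →ₗ[R] V) W.1 : ℚ) =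
        ∑ h : U ≃ₗ[R] U, (if ∀ u, g (ι W (.refl R U) u) = ι W h u then (1 : ℚ) else 0) *
          mobius (h : U →ₗ[R] U) := by
      intro g
      by_cases hg : W.1 ≤ W.1.comap (g : V →ₗ[R] V)
      · let g' : W.1 ≃ₗ[R] W.1 := LinearEquiv.ofBijective ((g : V →ₗ[R] V).restrict hg)
          (Finite.injective_iff_bijective.1 fun v w h => Subtype.ext
            (g.injective (congrArg Subtype.val h)))
        have hg' : ∀ w, (g' w : V) = g w := fun w => rfl
        let h₀ : U ≃ₗ[R] U := (e W).trans (g'.trans (e W).symm)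
        have hh₀ : ∀ u, e W (h₀ u) = g' (e W u) := fun u => by simp [h₀]
        rw [Finset.sum_eq_single h₀]
        · rw [if_pos, one_mul, mobiusRestrict, dif_pos hg]
          · exact congrArg _ (mobius_congr (e W) fun u => hh₀ u).symm
          · intro u
            change g (e W u) = (e W (h₀ u) : V)
            rw [hh₀, hg']
        · intro h _ hne
          rw [if_neg, zero_mul]
          intro H
          refine hne (LinearEquiv.ext fun u => (e W).injective (Subtype.ext ?_))
          rw [hh₀, hg']
          exact (H u).symm
        · simp
      · rw [mobiusRestrict, dif_neg hg, Int.cast_zero, Finset.sum_eq_zero]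
        intro h _
        rw [if_neg, zero_mul]
        intro H
        refine hg fun v hv => ?_
        have := H ((e W).symm ⟨v, hv⟩)
        simp only [ι, LinearMap.comp_apply, LinearEquiv.coe_coe, LinearEquiv.refl_apply,
          LinearEquiv.apply_symm_apply, Submodule.subtype_apply] at this
        change g v ∈ W.1
        rw [this]
        exact Subtype.coe_prop _
    rw [Finset.sum_congr rfl fun g _ => h1 g, Finset.sum_comm, Finset.mul_sum]
    refine Finset.sum_congr rfl fun h _ => ?_
    rw [← Finset.sum_mul, hcount _ _ (hι _ _) (hι _ _)]
  -- The embedding `g ∘ j₀` is determined by its image `W` and an automorphism of `U`, so each `g`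
  -- belongs to exactly one pair.
  have hcard : (Nat.card (V ≃ₗ[R] V) : ℚ) = κ * (Nat.card 𝒲 * Nat.card (U ≃ₗ[R] U)) := by
    have h1 : ∀ g : V ≃ₗ[R] V, (1 : ℚ) = ∑ x : 𝒲 × (U ≃ₗ[R] U),
        if ∀ u, g (j₀ u) = ι x.1 x.2 u then (1 : ℚ) else 0 := by
      intro g
      let j : U →ₗ[R] V := (g : V →ₗ[R] V) ∘ₗ j₀
      have hj : Function.Injective j := g.injective.comp hj₀
      let W : 𝒲 := ⟨LinearMap.range j, ⟨LinearEquiv.ofInjective j hj⟩⟩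
      let h₀ : U ≃ₗ[R] U := (LinearEquiv.ofInjective j hj).trans (e W).symm
      have hh₀ : ∀ u, (e W (h₀ u) : V) = g (j₀ u) := fun u => by
        simp only [h₀, LinearEquiv.trans_apply, LinearEquiv.apply_symm_apply]
        rfl
      rw [Finset.sum_eq_single (W, h₀)]
      · rw [if_pos]
        exact fun u => (hh₀ u).symm
      · rintro ⟨W', h⟩ _ hne
        rw [if_neg]
        intro H
        have hW : W' = W := by
          apply Subtype.ext
          ext v
          constructor
          · intro hv
            refine ⟨h.symm ((e W').symm ⟨v, hv⟩), ?_⟩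
            refine (H _).trans ?_
            simp [ι]
          · rintro ⟨u, rfl⟩
            have : j u = ι W' h u := H u
            rw [this]
            exact Subtype.coe_prop _
        subst hW
        refine hne (Prod.ext rfl (LinearEquiv.ext fun u => (e W).injective (Subtype.ext ?_)))
        change (e W (h u) : V) = e W (h₀ u)
        rw [hh₀]
        exact (H u).symm
      · simp
    calc (Nat.card (V ≃ₗ[R] V) : ℚ) = ∑ g : V ≃ₗ[R] V, (1 : ℚ) := by simp
      _ = ∑ x : 𝒲 × (U ≃ₗ[R] U), (κ : ℚ) := by
        rw [Finset.sum_congr rfl fun g _ => h1 g, Finset.sum_comm]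
        exact Finset.sum_congr rfl fun x _ => hcount _ _ hj₀ (hι _ _)
      _ = _ := by
        simp [Fintype.card_prod]
        ring
  rw [Finset.sum_subtype _ (p := fun W : Submodule R V => Nonempty (U ≃ₗ[R] W)) (by simp),
    Finset.sum_congr rfl fun W _ => hsum W, sum_mobius_eq, hcard, Finset.sum_const,
    Finset.card_univ, ← Nat.card_eq_fintype_card, nsmul_eq_mul]
  ring

/-- The Möbius function of the chain `ℕ`, based at `0`. -/
def chainMobius : ℕ → ℤ
  | 0 => 1
  | 1 => -1
  | _ => 0

theorem sum_chainMobius (m : ℕ) : ∑ j ∈ Finset.Iic m, chainMobius j = if m = 0 then 1 else 0 := by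
  have hI : Finset.Iic m = Finset.range (m + 1) := by
    ext j
    simp
  rw [hI]
  clear hI
  induction m with
  | zero => rfl
  | succ k ih =>
    rw [Finset.sum_range_succ, ih]
    rcases k with _ | k <;> simp [chainMobius]

/-- `sum_mobiusRestrict` is summed over all automorphisms and the submodules are grouped by type;
the types that occur are precisely the `t ≤ T`. -/
theorem sum_weight_stdModule [Fintype (MaximalSpectrum R)] [DecidableEq (MaximalSpectrum R)]
    {T : MaximalSpectrum R → ℕ} (hT : T ≠ 0) :
    ∑ t ∈ Finset.Iic T, weight R (StdModule t) = 0 := by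
  classical
  let V := StdModule T
  have : Fintype (Submodule R V) := Fintype.ofFinite _
  have : Fintype (V ≃ₗ[R] V) := Fintype.ofFinite _
  obtain ⟨i, hi⟩ : ∃ i, T i ≠ 0 := by
    by_contra! h
    exact hT (funext h)
  have : Nontrivial V := by
    have := Ideal.Quotient.nontrivial_iff.2 i.isMaximal.ne_top
    have : Nonempty (Fin (T i)) := ⟨⟨0, Nat.pos_of_ne_zero hi⟩⟩
    exact Pi.nontrivial_at i
  choose ty hty using fun W : Submodule R V => exists_linearEquiv_stdModule (R := R) (V := W)
  have hle : ∀ W ∈ (Finset.univ : Finset (Submodule R V)), ty W ∈ Finset.Iic T := by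
    intro W _
    rw [Finset.mem_Iic]
    exact le_of_injective_stdModule (W.subtype ∘ₗ ((hty W).some.symm : StdModule (ty W) →ₗ[R] W))
      (W.injective_subtype.comp (hty W).some.symm.injective)
  have hfib : ∀ t ∈ Finset.Iic T, ∑ W ∈ Finset.univ.filter fun W : Submodule R V => ty W = t,
      ∑ g : V ≃ₗ[R] V, (mobiusRestrict (g : V →ₗ[R] V) W : ℚ) =
        Nat.card (V ≃ₗ[R] V) * weight R (StdModule t) := by
    intro t ht
    obtain ⟨j₀, hj₀⟩ := exists_injective_stdModule (Finset.mem_Iic.1 ht)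
    rw [← sum_sum_mobiusRestrict hj₀]
    refine Finset.sum_congr (Finset.filter_congr fun W _ => ⟨?_, ?_⟩) fun _ _ => rfl
    · rintro rfl
      exact ⟨(hty W).some.symm⟩
    · rintro ⟨f⟩
      exact stdModule_injective ((hty W).some.symm.trans f.symm)
  have hzero : ∑ W : Submodule R V, ∑ g : V ≃ₗ[R] V,
      (mobiusRestrict (g : V →ₗ[R] V) W : ℚ) = 0 := by
    rw [Finset.sum_comm]
    refine Finset.sum_eq_zero fun g _ => ?_
    exact_mod_cast sum_mobiusRestrict (g : V →ₗ[R] V)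
  rw [← Finset.sum_fiberwise_of_maps_to hle, Finset.sum_congr rfl hfib, ← Finset.mul_sum] at hzero
  exact (mul_eq_zero.1 hzero).resolve_left (Nat.cast_ne_zero.2 Nat.card_pos.ne')

/-- Both sides are $1$ at $0$ and have vanishing sums over `Finset.Iic T` for `T ≠ 0`. This
determines them by induction; on the right the sum factors over the coordinates. -/
theorem weight_stdModule [Fintype (MaximalSpectrum R)] (T : MaximalSpectrum R → ℕ) :
    weight R (StdModule T) = ∏ i, (chainMobius (T i) : ℚ) := by
  classical
  induction T using WellFoundedLT.induction with
  | _ T ih =>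
  by_cases hT : T = 0
  · subst hT
    have : Subsingleton (StdModule (R := R) 0) := by
      refine ⟨fun v w => ?_⟩
      funext i j
      exact j.elim0
    rw [weight_of_subsingleton]
    simp [chainMobius]
  · have h1 := sum_weight_stdModule hT
    have h2 : ∑ t ∈ Finset.Iic T, ∏ i, (chainMobius (t i) : ℚ) = 0 := by
      have : Finset.Iic T = Fintype.piFinset fun i => Finset.Iic (T i) := by
        ext t
        simp [Pi.le_def]
      rw [this, ← Finset.prod_univ_sum (fun i => Finset.Iic (T i))
        (fun _ j => (chainMobius j : ℚ))]
      obtain ⟨i, hi⟩ : ∃ i, T i ≠ 0 := by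
        by_contra! h
        exact hT (funext h)
      refine Finset.prod_eq_zero (Finset.mem_univ i) ?_
      have := sum_chainMobius (T i)
      rw [if_neg hi] at this
      exact_mod_cast this
    rw [← Finset.add_sum_erase _ _ (Finset.mem_Iic.2 le_rfl)] at h1 h2
    have h3 : ∑ t ∈ (Finset.Iic T).erase T, weight R (StdModule t) =
        ∑ t ∈ (Finset.Iic T).erase T, ∏ i, (chainMobius (t i) : ℚ) := by
      refine Finset.sum_congr rfl fun t ht => ih t ?_
      rw [Finset.mem_erase, Finset.mem_Iic] at ht
      exact lt_of_le_of_ne ht.2 ht.1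
    rw [h3] at h1
    linarith

end Weight

/-! ### Matrix representations as modules over the group algebra -/

section Rep

variable {F : Type*} [Field F] {A : Type*} [CommGroup A] {n : ℕ}

/-- The endomorphism of `F ^ n` given by an invertible matrix. -/
noncomputable def matrixEnd : GL (Fin n) F →* Module.End F (Fin n → F) :=
  (Matrix.toLinAlgEquiv' (R := F) (n := Fin n) : _ →* _).comp
    (Units.coeHom (Matrix (Fin n) (Fin n) F))

theorem matrixEnd_apply (g : GL (Fin n) F) (v : Fin n → F) :
    matrixEnd g v = Matrix.mulVec (g : Matrix (Fin n) (Fin n) F) v := rfl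

theorem matrixEnd_injective : Function.Injective (matrixEnd (F := F) (n := n)) := fun _ _ h =>
  Units.ext (Matrix.toLinAlgEquiv'.injective h)

/-- The space `F ^ n`, as a module over the group algebra through a matrix representation. -/
def RepModule (_ρ : A →* GL (Fin n) F) : Type _ := Fin n → F

variable (ρ : A →* GL (Fin n) F)

instance : AddCommGroup (RepModule ρ) := inferInstanceAs (AddCommGroup (Fin n → F))

instance : Module F (RepModule ρ) := inferInstanceAs (Module F (Fin n → F))

instance [Finite F] : Finite (RepModule ρ) := inferInstanceAs (Finite (Fin n → F))

instance [NeZero n] : Nontrivial (RepModule ρ) := inferInstanceAs (Nontrivial (Fin n → F))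

noncomputable instance : Module (MonoidAlgebra F A) (RepModule ρ) :=
  Module.compHom (Fin n → F)
    (MonoidAlgebra.lift F (Module.End F (Fin n → F)) A (matrixEnd.comp ρ)).toRingHom

/-- The identification of the underlying space of the module of a representation. -/
def RepModule.equiv : RepModule ρ ≃ₗ[F] (Fin n → F) := LinearEquiv.refl F (Fin n → F)

theorem RepModule.equiv_smul (x : MonoidAlgebra F A) (v : RepModule ρ) :
    RepModule.equiv ρ (x • v) =
      MonoidAlgebra.lift F (Module.End F (Fin n → F)) A (matrixEnd.comp ρ) x
        (RepModule.equiv ρ v) := rfl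

theorem RepModule.equiv_single_smul (a : A) (v : RepModule ρ) :
    RepModule.equiv ρ ((MonoidAlgebra.single a 1 : MonoidAlgebra F A) • v) =
      matrixEnd (ρ a) (RepModule.equiv ρ v) := by
  rw [RepModule.equiv_smul, MonoidAlgebra.lift_single, one_smul]
  rfl

instance : IsScalarTower F (MonoidAlgebra F A) (RepModule ρ) where
  smul_assoc c x v := by
    apply (RepModule.equiv ρ).injective
    rw [(RepModule.equiv ρ).map_smul, RepModule.equiv_smul, RepModule.equiv_smul, map_smul]
    rfl

/-- The matrix of an automorphism of `F ^ n`. -/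
noncomputable def matrixOfEquiv (e : (Fin n → F) ≃ₗ[F] (Fin n → F)) : GL (Fin n) F :=
  Matrix.GeneralLinearGroup.toLin.symm
    ((LinearMap.GeneralLinearGroup.generalLinearEquiv F (Fin n → F)).symm e)

theorem matrixEnd_matrixOfEquiv (e : (Fin n → F) ≃ₗ[F] (Fin n → F)) (v : Fin n → F) :
    matrixEnd (matrixOfEquiv e) v = e v := by
  have h : Matrix.GeneralLinearGroup.toLin (matrixOfEquiv e) =
      (LinearMap.GeneralLinearGroup.generalLinearEquiv F (Fin n → F)).symm e :=
    MulEquiv.apply_symm_apply _ _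
  exact congrArg (fun u : LinearMap.GeneralLinearGroup F (Fin n → F) =>
    (u : Module.End F (Fin n → F)) v) h

variable {ρ}

/-- The endomorphism of the module of a representation given by a commuting matrix. -/
noncomputable def RepModule.endOfCommute {g : GL (Fin n) F} (hg : ∀ a, Commute g (ρ a)) :
    Module.End (MonoidAlgebra F A) (RepModule ρ) :=
  MonoidAlgebra.equivariantOfLinearOfComm
    ((RepModule.equiv ρ).symm.toLinearMap ∘ₗ matrixEnd g ∘ₗ (RepModule.equiv ρ).toLinearMap)
    fun a v => by
      apply (RepModule.equiv ρ).injective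
      have h := congrArg (fun f : Module.End F (Fin n → F) => f (RepModule.equiv ρ v))
        (congrArg matrixEnd (hg a).eq)
      simp only [map_mul, Module.End.mul_apply] at h
      simpa only [LinearMap.comp_apply, LinearEquiv.coe_coe, LinearEquiv.apply_symm_apply,
        RepModule.equiv_single_smul] using h

theorem RepModule.equiv_endOfCommute {g : GL (Fin n) F} (hg : ∀ a, Commute g (ρ a))
    (v : RepModule ρ) :
    RepModule.equiv ρ (RepModule.endOfCommute hg v) = matrixEnd g (RepModule.equiv ρ v) := by
  simp [RepModule.endOfCommute, MonoidAlgebra.equivariantOfLinearOfComm]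

variable (ρ) in
/-- The automorphisms of the module of a representation are its commuting matrices. -/
noncomputable def RepModule.autEquiv :
    {g : GL (Fin n) F // ∀ a, Commute g (ρ a)} ≃
      (RepModule ρ ≃ₗ[MonoidAlgebra F A] RepModule ρ) where
  toFun g := LinearEquiv.ofLinearMap (RepModule.endOfCommute g.2)
    (RepModule.endOfCommute fun a => (g.2 a).inv_left)
    (LinearMap.ext fun v => (RepModule.equiv ρ).injective (by
      simp [RepModule.equiv_endOfCommute]))
    (LinearMap.ext fun v => (RepModule.equiv ρ).injective (by
      simp [RepModule.equiv_endOfCommute]))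
  invFun e := ⟨matrixOfEquiv ((RepModule.equiv ρ).symm.trans
      ((e.restrictScalars F).trans (RepModule.equiv ρ))), fun a => matrixEnd_injective (by
    rw [map_mul, map_mul]
    refine LinearMap.ext fun v => ?_
    rw [Module.End.mul_apply, Module.End.mul_apply, matrixEnd_matrixOfEquiv,
      matrixEnd_matrixOfEquiv]
    have h1 := e.map_smul (MonoidAlgebra.single a 1 : MonoidAlgebra F A)
      ((RepModule.equiv ρ).symm v)
    have h2 := RepModule.equiv_single_smul ρ a ((RepModule.equiv ρ).symm v)
    rw [LinearEquiv.apply_symm_apply] at h2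
    have h3 := congrArg (RepModule.equiv ρ) h1
    rw [RepModule.equiv_single_smul] at h3
    rw [← h2]
    simpa using h3)⟩
  left_inv g := Subtype.ext (matrixEnd_injective (LinearMap.ext fun v => by
    simp [matrixEnd_matrixOfEquiv, RepModule.equiv_endOfCommute]))
  right_inv e := LinearEquiv.ext fun v => (RepModule.equiv ρ).injective (by
    simp [matrixEnd_matrixOfEquiv, RepModule.equiv_endOfCommute])

theorem RepModule.coe_autEquiv (g : {g : GL (Fin n) F // ∀ a, Commute g (ρ a)}) :
    (RepModule.autEquiv ρ g : RepModule ρ →ₗ[MonoidAlgebra F A] RepModule ρ) =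
      RepModule.endOfCommute g.2 := rfl

theorem monoidHom_ext_of_matrixEnd {ρ' : A →* GL (Fin n) F}
    (h : ∀ a v, matrixEnd (ρ a) v = matrixEnd (ρ' a) v) : ρ = ρ' :=
  MonoidHom.ext fun a => matrixEnd_injective (LinearMap.ext (h a))

/-- Transport of structure: a module over the group algebra, together with an `F`-linear
identification with `F ^ n`, amounts to an isomorphism with the module of a representation. -/
theorem bijective_restrictScalars (U : Type*) [AddCommGroup U] [Module F U]
    [Module (MonoidAlgebra F A) U] [IsScalarTower F (MonoidAlgebra F A) U] :
    Function.Bijective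
      (fun x : (Σ ρ : A →* GL (Fin n) F, U ≃ₗ[MonoidAlgebra F A] RepModule ρ) =>
        (x.2.restrictScalars F).trans (RepModule.equiv x.1)) := by
  constructor
  · rintro ⟨ρ, e⟩ ⟨ρ', e'⟩ h
    have h' : ∀ u, RepModule.equiv ρ (e u) = RepModule.equiv ρ' (e' u) := fun u =>
      congrArg (fun f : U ≃ₗ[F] (Fin n → F) => f u) h
    have hρ : ρ = ρ' := by
      refine monoidHom_ext_of_matrixEnd fun a v => ?_
      obtain ⟨u, rfl⟩ := (e.toEquiv.trans (RepModule.equiv ρ).toEquiv).surjective v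
      have h1 := h' ((MonoidAlgebra.single a 1 : MonoidAlgebra F A) • u)
      rw [e.map_smul, e'.map_smul, RepModule.equiv_single_smul, RepModule.equiv_single_smul,
        ← h'] at h1
      exact h1
    subst hρ
    congr 1
    exact LinearEquiv.ext fun u => (RepModule.equiv ρ).injective (h' u)
  · intro e
    let f : A →* (U ≃ₗ[F] U) :=
      { toFun := fun a => LinearEquiv.ofLinearMap
          (Algebra.lsmul F F U (MonoidAlgebra.single a 1 : MonoidAlgebra F A))
          (Algebra.lsmul F F U (MonoidAlgebra.single a⁻¹ 1 : MonoidAlgebra F A))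
          (LinearMap.ext fun u => by
            simp [← mul_smul, MonoidAlgebra.single_mul_single, ← MonoidAlgebra.one_def])
          (LinearMap.ext fun u => by
            simp [← mul_smul, MonoidAlgebra.single_mul_single, ← MonoidAlgebra.one_def])
        map_one' := LinearEquiv.ext fun u => by simp [← MonoidAlgebra.one_def]
        map_mul' := fun a b => LinearEquiv.ext fun u => by
          simp [← mul_smul, MonoidAlgebra.single_mul_single] }
    have hf : ∀ a u, f a u = (MonoidAlgebra.single a 1 : MonoidAlgebra F A) • u := fun _ _ => rfl
    let ρ : A →* GL (Fin n) F :=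
      { toFun := fun a => matrixOfEquiv (e.symm.trans ((f a).trans e))
        map_one' := matrixEnd_injective (LinearMap.ext fun v => by
          rw [matrixEnd_matrixOfEquiv]
          simp)
        map_mul' := fun a b => matrixEnd_injective (LinearMap.ext fun v => by
          rw [map_mul f, map_mul matrixEnd, Module.End.mul_apply]
          simp only [matrixEnd_matrixOfEquiv]
          simp) }
    have hρ : ∀ a v, matrixEnd (ρ a) v = e (f a (e.symm v)) := fun a v =>
      matrixEnd_matrixOfEquiv _ v
    let e0 : U ≃ₗ[F] RepModule ρ := e.trans (RepModule.equiv ρ).symm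
    let e1 : U →ₗ[MonoidAlgebra F A] RepModule ρ :=
      MonoidAlgebra.equivariantOfLinearOfComm e0.toLinearMap fun a u => by
        apply (RepModule.equiv ρ).injective
        rw [RepModule.equiv_single_smul, hρ]
        simp [e0, hf]
    refine ⟨⟨ρ, LinearEquiv.ofBijective e1 e0.bijective⟩, LinearEquiv.ext fun u => ?_⟩
    change RepModule.equiv ρ (e0 u) = e u
    simp [e0]

instance finite_monoidHom {M N : Type*} [Monoid M] [Monoid N] [Finite M] [Finite N] :
    Finite (M →* N) := DFunLike.finite _

instance finite_monoidAlgebra [Finite F] [Finite A] : Finite (MonoidAlgebra F A) :=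
  Module.finite_of_finite F

/-- An isomorphism from `U` to the module of some `ρ` is the same as an `F`-linear isomorphism from
`U` to $F^n$, which determines `ρ`; these form a torsor under $\mathrm{GL}_n$. -/
theorem sum_card_linearEquiv [Finite F] [Fintype (A →* GL (Fin n) F)] {U : Type*} [AddCommGroup U]
    [Module F U] [Module (MonoidAlgebra F A) U] [IsScalarTower F (MonoidAlgebra F A) U]
    [Finite U] (hU : Module.finrank F U = n) :
    ∑ ρ : A →* GL (Fin n) F, Nat.card (U ≃ₗ[MonoidAlgebra F A] RepModule ρ) =
      Nat.card (GL (Fin n) F) := by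
  classical
  have : Module.Finite F U := inferInstance
  have hU' : Module.finrank F U = Module.finrank F (Fin n → F) := by simp [hU]
  have e : U ≃ₗ[F] (Fin n → F) := LinearEquiv.ofFinrankEq U (Fin n → F) hU'
  rw [← Nat.card_sigma, Nat.card_congr (Equiv.ofBijective _ (bijective_restrictScalars U))]
  refine Nat.card_congr
    { toFun := fun g => matrixOfEquiv (e.symm.trans g)
      invFun := fun g => e.trans (LinearMap.GeneralLinearGroup.generalLinearEquiv F (Fin n → F)
        (Matrix.GeneralLinearGroup.toLin g))
      left_inv := fun g => by
        ext u
        simp [matrixOfEquiv]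
      right_inv := fun g => by
        refine matrixEnd_injective (LinearMap.ext fun v => ?_)
        rw [matrixEnd_matrixOfEquiv]
        simp [matrixEnd_apply] }

variable [Finite A]

/-- The `F`-dimension of the standard semisimple module with multiplicities `t`. -/
noncomputable def stdDim [Fintype (MaximalSpectrum (MonoidAlgebra F A))]
    (t : MaximalSpectrum (MonoidAlgebra F A) → ℕ) : ℕ :=
  ∑ i, t i * Module.finrank F (MonoidAlgebra F A ⧸ i.asIdeal)

theorem finrank_stdModule [Fintype (MaximalSpectrum (MonoidAlgebra F A))]
    (t : MaximalSpectrum (MonoidAlgebra F A) → ℕ) :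
    Module.finrank F (StdModule t) = stdDim t := by
  rw [Module.finrank_pi_fintype]
  refine Finset.sum_congr rfl fun i _ => ?_
  rw [Module.finrank_pi_fintype]
  simp

theorem finrank_quotient_pos (i : MaximalSpectrum (MonoidAlgebra F A)) :
    0 < Module.finrank F (MonoidAlgebra F A ⧸ i.asIdeal) := by
  have := Ideal.Quotient.nontrivial_iff.2 i.isMaximal.ne_top
  exact Module.finrank_pos

theorem le_stdDim [Fintype (MaximalSpectrum (MonoidAlgebra F A))]
    (t : MaximalSpectrum (MonoidAlgebra F A) → ℕ) (i : MaximalSpectrum (MonoidAlgebra F A)) :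
    t i ≤ stdDim t :=
  (Nat.le_mul_of_pos_right _ (finrank_quotient_pos i)).trans
    (Finset.single_le_sum (f := fun i => t i * Module.finrank F (MonoidAlgebra F A ⧸ i.asIdeal))
      (fun _ _ => Nat.zero_le _) (Finset.mem_univ i))

variable [Finite F]

/-- The condition on `Nat.card A` makes the group algebra semisimple. For fixed `ρ` the sum over the
commutant is $|\mathrm{Aut}|$ times the weight, and $|\mathrm{Aut}|$ is the number of isomorphisms
from the standard module of its type. Other types have no isomorphisms, so all `t` can be included
and the sum over `ρ` carried out first. -/
theorem sum_mobius_rep [NeZero (Nat.card A : F)] [Fintype (A →* GL (Fin n) F)]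
    [∀ ρ : A →* GL (Fin n) F, Fintype {g : GL (Fin n) F // ∀ a, Commute g (ρ a)}]
    [Fintype (MaximalSpectrum (MonoidAlgebra F A))]
    [DecidableEq (MaximalSpectrum (MonoidAlgebra F A))] :
    ∑ ρ : A →* GL (Fin n) F, ∑ g : {g : GL (Fin n) F // ∀ a, Commute g (ρ a)},
      (mobius (RepModule.endOfCommute g.2) : ℚ) =
    Nat.card (GL (Fin n) F) *
      ∑ t ∈ (Fintype.piFinset fun _ : MaximalSpectrum (MonoidAlgebra F A) =>
        Finset.range (n + 1)).filter (fun t => stdDim t = n), ∏ i, (chainMobius (t i) : ℚ) := by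
  classical
  set D := (Fintype.piFinset fun _ : MaximalSpectrum (MonoidAlgebra F A) =>
        Finset.range (n + 1)).filter (fun t => stdDim t = n) with hD
  -- The box loses nothing: residue degrees are positive, so a multiplicity cannot exceed the
  -- dimension.
  have hmem : ∀ t, t ∈ D ↔ stdDim t = n := by
    intro t
    simp only [hD, Finset.mem_filter, Fintype.mem_piFinset, Finset.mem_range, Nat.lt_succ_iff,
      and_iff_right_iff_imp]
    rintro rfl i
    exact le_stdDim t i
  have h1 : ∀ ρ : A →* GL (Fin n) F, ∑ g : {g : GL (Fin n) F // ∀ a, Commute g (ρ a)},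
      (mobius (RepModule.endOfCommute g.2) : ℚ) = ∑ t ∈ D,
        (Nat.card (StdModule t ≃ₗ[MonoidAlgebra F A] RepModule ρ) : ℚ) *
          ∏ i, (chainMobius (t i) : ℚ) := by
    intro ρ
    have : Fintype (RepModule ρ ≃ₗ[MonoidAlgebra F A] RepModule ρ) := Fintype.ofFinite _
    obtain ⟨t, ⟨e⟩⟩ := exists_linearEquiv_stdModule (R := MonoidAlgebra F A) (V := RepModule ρ)
    have ht : t ∈ D := by
      rw [hmem, ← finrank_stdModule, ← (e.restrictScalars F).finrank_eq,
        (RepModule.equiv ρ).finrank_eq]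
      simp
    rw [Finset.sum_eq_single t]
    · rw [← weight_stdModule, ← weight_congr e, ← Nat.card_congr
        (⟨fun f => e.trans f, fun f => e.symm.trans f, fun f => by ext; simp,
          fun f => by ext; simp⟩ : (StdModule t ≃ₗ[MonoidAlgebra F A] RepModule ρ) ≃
            (RepModule ρ ≃ₗ[MonoidAlgebra F A] RepModule ρ)).symm, ← sum_mobius_eq]
      exact Fintype.sum_equiv (RepModule.autEquiv ρ) _ _ fun g => by rw [RepModule.coe_autEquiv]
    · intro t' _ hne
      have : IsEmpty (StdModule t' ≃ₗ[MonoidAlgebra F A] RepModule ρ) :=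
        ⟨fun f => hne (stdModule_injective (f.trans e))⟩
      simp
    · exact fun h => absurd ht h
  rw [Finset.sum_congr rfl fun ρ _ => h1 ρ, Finset.sum_comm, Finset.mul_sum]
  refine Finset.sum_congr rfl fun t ht => ?_
  rw [← Finset.sum_mul, ← Nat.cast_sum, sum_card_linearEquiv]
  rw [finrank_stdModule]
  exact (hmem t).1 ht

end Rep

/-! ### Fixed subspaces as invariant submodules, and contractibility -/

section Fixed

variable {F : Type*} [Field F] {n : ℕ}

theorem matrixEnd_bijective (g : GL (Fin n) F) : Function.Bijective (matrixEnd g) := by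
  have key : ∀ h : GL (Fin n) F, ∀ v, matrixEnd h⁻¹ (matrixEnd h v) = v := fun h v => by
    rw [← Module.End.mul_apply, ← map_mul, inv_mul_cancel, map_one]
    rfl
  exact Function.bijective_iff_has_inverse.2 ⟨matrixEnd g⁻¹, key g, fun v => by simp⟩

theorem map_matrixEnd_eq {g : GL (Fin n) F} {W : Submodule F (Fin n → F)}
    (h : ∀ v ∈ W, matrixEnd g v ∈ W) : W.map (matrixEnd g) = W := by
  refine Submodule.eq_of_le_of_finrank_eq ?_ ?_
  · rintro _ ⟨v, hv, rfl⟩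
    exact h v hv
  · exact (Submodule.equivMapOfInjective _ (matrixEnd_bijective g).1 W).finrank_eq.symm

/-- The invertible matrices that stabilize a subspace. -/
def subspaceStabilizer (W : Submodule F (Fin n → F)) : Subgroup (GL (Fin n) F) where
  carrier := {g | W.map (matrixEnd g) = W}
  one_mem' := by
    change W.map (matrixEnd 1) = W
    rw [map_one]
    exact Submodule.map_id W
  mul_mem' {g h} hg hh := by
    change W.map (matrixEnd (g * h)) = W
    rw [map_mul, Module.End.mul_eq_comp, Submodule.map_comp]
    exact (congrArg _ hh).trans hg
  inv_mem' {g} hg := by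
    change W.map (matrixEnd g⁻¹) = W
    have hg' : W.map (matrixEnd g) = W := hg
    conv_lhs => rw [← hg']
    rw [← Submodule.map_comp, ← Module.End.mul_eq_comp, ← map_mul, inv_mul_cancel, map_one]
    exact Submodule.map_id W

theorem mem_subspaceStabilizer {W : Submodule F (Fin n → F)} {g : GL (Fin n) F} :
    g ∈ subspaceStabilizer W ↔ ∀ v ∈ W, matrixEnd g v ∈ W :=
  ⟨fun h _ hv => (h : W.map (matrixEnd g) = W) ▸ Submodule.mem_map_of_mem hv, map_matrixEnd_eq⟩

theorem FixedSubspace.apply_mem {H : Subgroup (GL (Fin n) F)} (W : FixedSubspace H)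
    {g : GL (Fin n) F} (hg : g ∈ H) {v : Fin n → F} (hv : v ∈ W.1.1) : matrixEnd g v ∈ W.1.1 :=
  mem_subspaceStabilizer.1 (W.2 g hg) v hv

variable {A : Type*} [CommGroup A] {ρ : A →* GL (Fin n) F}

/-- The subspaces fixed by the group generated by a representation and a commuting matrix are the
invariant submodules of the module of the representation. -/
noncomputable def FixedSubspace.orderIso {g : GL (Fin n) F} (hg : ∀ a, Commute g (ρ a))
    {H : Subgroup (GL (Fin n) F)} (hH : H = Subgroup.closure (insert g (Set.range ρ))) :
    FixedSubspace H ≃o InvariantProper (RepModule.endOfCommute hg) where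
  toFun W := ⟨MonoidAlgebra.submoduleOfSMulMem (W.1.1.comap (RepModule.equiv ρ).toLinearMap)
      (fun a v hv => by
        change RepModule.equiv ρ ((MonoidAlgebra.single a 1 : MonoidAlgebra F A) • v) ∈ W.1.1
        rw [RepModule.equiv_single_smul]
        exact W.apply_mem (hH ▸ Subgroup.subset_closure (Or.inr ⟨a, rfl⟩)) hv), by
      refine ⟨⟨fun h => W.1.2.1 ?_, fun h => W.1.2.2 ?_⟩, fun v hv => ?_⟩
      · refine (Submodule.eq_bot_iff _).2 fun v hv => ?_
        have : (RepModule.equiv ρ).symm v ∈ (⊥ : Submodule (MonoidAlgebra F A) (RepModule ρ)) := by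
          rw [← h]
          change RepModule.equiv ρ ((RepModule.equiv ρ).symm v) ∈ W.1.1
          simpa using hv
        simpa using this
      · refine Submodule.eq_top_iff'.2 fun v => ?_
        have : (RepModule.equiv ρ).symm v ∈ (⊤ : Submodule (MonoidAlgebra F A) (RepModule ρ)) :=
          Submodule.mem_top
        rw [← h] at this
        change RepModule.equiv ρ ((RepModule.equiv ρ).symm v) ∈ W.1.1 at this
        simpa using this
      · change RepModule.equiv ρ (RepModule.endOfCommute hg v) ∈ W.1.1
        rw [RepModule.equiv_endOfCommute]
        exact W.apply_mem (hH ▸ Subgroup.subset_closure (Or.inl rfl)) hv⟩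
  invFun W := ⟨⟨(W.1.restrictScalars F).comap (RepModule.equiv ρ).symm.toLinearMap, by
      refine ⟨fun h => W.2.1.1 ?_, fun h => W.2.1.2 ?_⟩
      · refine (Submodule.eq_bot_iff _).2 fun v hv => ?_
        have : RepModule.equiv ρ v ∈ (⊥ : Submodule F (Fin n → F)) := by
          rw [← h]
          simpa using hv
        simpa using this
      · refine Submodule.eq_top_iff'.2 fun v => ?_
        have : RepModule.equiv ρ v ∈ (⊤ : Submodule F (Fin n → F)) := Submodule.mem_top
        rw [← h] at this
        simpa using this⟩, by
      suffices H ≤ subspaceStabilizer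
          ((W.1.restrictScalars F).comap (RepModule.equiv ρ).symm.toLinearMap) from
        fun h hh => this hh
      rw [hH, Subgroup.closure_le]
      rintro _ (rfl | ⟨a, rfl⟩)
      · refine mem_subspaceStabilizer.2 fun v hv => ?_
        have h1 : RepModule.endOfCommute hg ((RepModule.equiv ρ).symm v) ∈ W.1 := W.2.2 hv
        have h2 := RepModule.equiv_endOfCommute hg ((RepModule.equiv ρ).symm v)
        rw [LinearEquiv.apply_symm_apply] at h2
        rw [← h2, Submodule.mem_comap, LinearEquiv.coe_coe, LinearEquiv.symm_apply_apply]
        exact h1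
      · refine mem_subspaceStabilizer.2 fun v hv => ?_
        have h1 : (MonoidAlgebra.single a 1 : MonoidAlgebra F A) • (RepModule.equiv ρ).symm v ∈ W.1 :=
          W.1.smul_mem _ hv
        have h2 := RepModule.equiv_single_smul ρ a ((RepModule.equiv ρ).symm v)
        rw [LinearEquiv.apply_symm_apply] at h2
        rw [← h2, Submodule.mem_comap, LinearEquiv.coe_coe, LinearEquiv.symm_apply_apply]
        exact h1⟩
  left_inv W := by
    refine Subtype.ext (Subtype.ext (SetLike.ext fun v => ?_))
    change RepModule.equiv ρ ((RepModule.equiv ρ).symm v) ∈ W.1.1 ↔ v ∈ W.1.1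
    rw [LinearEquiv.apply_symm_apply]
  right_inv W := by
    refine Subtype.ext (SetLike.ext fun v => ?_)
    change (RepModule.equiv ρ).symm (RepModule.equiv ρ v) ∈ W.1 ↔ v ∈ W.1
    rw [LinearEquiv.symm_apply_apply]
  map_rel_iff' {W W'} := by
    constructor
    · intro h v hv
      have h' := @h ((RepModule.equiv ρ).symm v) (by
        change RepModule.equiv ρ ((RepModule.equiv ρ).symm v) ∈ W.1.1
        rwa [LinearEquiv.apply_symm_apply])
      change RepModule.equiv ρ ((RepModule.equiv ρ).symm v) ∈ W'.1.1 at h'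
      rwa [LinearEquiv.apply_symm_apply] at h'
    · exact fun h v hv => h hv

theorem reducedEulerChar_fixedSubspace [Finite F] [NeZero n] {g : GL (Fin n) F}
    (hg : ∀ a, Commute g (ρ a)) {H : Subgroup (GL (Fin n) F)}
    (hH : H = Subgroup.closure (insert g (Set.range ρ))) :
    reducedEulerChar (FixedSubspace H) = mobius (RepModule.endOfCommute hg) := by
  rw [mobius_of_nontrivial]
  exact reducedEulerChar_congr (FixedSubspace.orderIso hg hH)

/-- If `H` has a nontrivial central `p`-subgroup, where `p` is the characteristic of `F`, then the poset of `H`-invariant subspaces is conically contractible. -/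
theorem reducedEulerChar_fixedSubspace_eq_zero [Finite F] [NeZero n] (p : ℕ) [Fact p.Prime]
    [CharP F p] {H Q : Subgroup (GL (Fin n) F)} (hQH : Q ≤ H) (hcomm : ∀ h ∈ H, ∀ x ∈ Q, Commute h x)
    (hQ : IsPGroup p Q) (hne : Q ≠ ⊥) : reducedEulerChar (FixedSubspace H) = 0 := by
  -- The apex of the cone is the fixed space of `Q`, with contraction $W\ge W\cap a\le a$. It is
  -- `H`-stable because `Q` is central, and proper because `Q` is nontrivial.
  let a : Submodule F (Fin n → F) :=
    { carrier := {v | ∀ x ∈ Q, matrixEnd x v = v}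
      zero_mem' := fun x _ => map_zero _
      add_mem' := fun hv hw x hx => by rw [map_add, hv x hx, hw x hx]
      smul_mem' := fun c v hv x hx => by rw [map_smul, hv x hx] }
  have hH : ∀ h ∈ H, a.map (matrixEnd h) = a := by
    intro h hh
    refine map_matrixEnd_eq fun v hv x hx => ?_
    rw [← Module.End.mul_apply, ← map_mul, ← (hcomm h hh x hx).eq, map_mul, Module.End.mul_apply,
      hv x hx]
  have hmeet : ∀ W : Submodule F (Fin n → F), W ≠ ⊥ → (∀ h ∈ H, ∀ v ∈ W, matrixEnd h v ∈ W) →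
      W ⊓ a ≠ ⊥ := by
    intro W hW hWH
    let _ : MulAction Q W :=
      { smul := fun x w => ⟨matrixEnd x.1 w.1, hWH _ (hQH x.2) _ w.2⟩
        one_smul := fun w => Subtype.ext (by
          change matrixEnd 1 w.1 = w.1
          rw [map_one]
          rfl)
        mul_smul := fun x y w => Subtype.ext (by
          change matrixEnd (x.1 * y.1) w.1 = matrixEnd x.1 (matrixEnd y.1 w.1)
          rw [map_mul]
          rfl) }
    have hsmul : ∀ (x : Q) (w : W), ((x • w : W) : Fin n → F) = matrixEnd x.1 w.1 :=
      fun _ _ => rfl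
    have : Nontrivial W := Submodule.nontrivial_iff_ne_bot.2 hW
    -- A `p`-group acting on a set of order divisible by `p` with the fixed point $0$ has a second
    -- fixed point, so `W` meets `a` nontrivially.
    have hdvd : p ∣ Nat.card W := by
      rw [Module.natCard_eq_pow_finrank (K := F)]
      exact dvd_pow ((CharP.cast_eq_zero_iff F p _).1 (by
        have := Fintype.ofFinite F
        rw [Nat.card_eq_fintype_card]
        exact FiniteField.cast_card_eq_zero F))
        Module.finrank_pos.ne'
    obtain ⟨b, hb, hb0⟩ := hQ.exists_fixed_point_of_prime_dvd_card_of_fixed_point W hdvd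
      (a := 0) (fun x => Subtype.ext (by rw [hsmul]; exact map_zero _))
    intro h
    refine hb0 (Subtype.ext ?_)
    have : b.1 ∈ W ⊓ a := ⟨b.2, fun x hx => by
      rw [← hsmul ⟨x, hx⟩ b, hb ⟨x, hx⟩]⟩
    rw [h, Submodule.mem_bot] at this
    exact this.symm
  have ha_bot : a ≠ ⊥ := by
    have := hmeet ⊤ top_ne_bot (fun _ _ _ _ => Submodule.mem_top)
    rwa [top_inf_eq] at this
  have ha_top : a ≠ ⊤ := by
    intro h
    refine hne ((Subgroup.eq_bot_iff_forall _).2 fun x hx => matrixEnd_injective ?_)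
    refine LinearMap.ext fun v => ?_
    have hv : v ∈ a := h ▸ Submodule.mem_top
    rw [hv x hx, map_one]
    rfl
  refine reducedEulerChar_eq_zero_of_conical (P := FixedSubspace H)
    (fun W => ⟨⟨W.1.1 ⊓ a, hmeet _ W.1.2.1 fun h hh v hv => W.apply_mem hh hv,
      fun h => ha_top (top_le_iff.1 (h.symm.le.trans inf_le_right))⟩, fun h hh => ?_⟩)
    (fun W W' h => inf_le_inf_right a h) (fun W => (inf_le_left : W.1.1 ⊓ a ≤ W.1.1))
    ⟨⟨a, ha_bot, ha_top⟩, hH⟩ (fun W => (inf_le_right : W.1.1 ⊓ a ≤ a))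
  refine map_matrixEnd_eq fun v hv => ⟨W.apply_mem hh hv.1, ?_⟩
  have := Submodule.mem_map_of_mem (f := matrixEnd h) hv.2
  rwa [hH h hh] at this

end Fixed

/-! ### Homomorphisms from the source group and their finite levels -/

section Source

variable {p : ℕ} [Fact p.Prime] {r N : ℕ} {G : Type*} [Group G]

/-- The finite quotient `(ℤ / p ^ N) ^ s` of `ℤ_p ^ s`, written multiplicatively. -/
abbrev FiniteQuotient (p N s : ℕ) : Type := Fin s → Multiplicative (ZMod (p ^ N))

/-- Reduction modulo `p ^ N` of the `p`-adic components. -/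
noncomputable def Source.reduce : Source p r →* FiniteQuotient p N (r - 1) where
  toFun x i := .ofAdd (PadicInt.toZModPow N ((Multiplicative.toAdd x).2 i))
  map_one' := funext fun _ => congrArg Multiplicative.ofAdd (map_zero _)
  map_mul' _ _ := funext fun _ => congrArg Multiplicative.ofAdd (map_add _ _ _)

/-- The inclusion of the `p`-adic components. -/
noncomputable def Source.inr (v : Fin (r - 1) → ℤ_[p]) : Source p r := .ofAdd (0, v)

/-- A generator of the integral component. -/
noncomputable def Source.gen : Source p r := .ofAdd (1, 0)

theorem Source.inr_add (v w : Fin (r - 1) → ℤ_[p]) :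
    (Source.inr (v + w) : Source p r) = Source.inr v * Source.inr w := by
  simp [Source.inr, ← ofAdd_add]

theorem Source.inr_nsmul (k : ℕ) (v : Fin (r - 1) → ℤ_[p]) :
    (Source.inr (k • v) : Source p r) = Source.inr v ^ k := by
  simp [Source.inr, ← ofAdd_nsmul]

theorem Source.eq_gen_zpow_mul_inr (x : Source p r) :
    x = Source.gen ^ (Multiplicative.toAdd x).1 * Source.inr (Multiplicative.toAdd x).2 := by
  rw [Source.gen, Source.inr, ← ofAdd_zsmul, ← ofAdd_add]
  apply Multiplicative.toAdd.injective
  ext <;> simp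

theorem Source.reduce_gen : Source.reduce (p := p) (r := r) (N := N) Source.gen = 1 :=
  funext fun _ => congrArg Multiplicative.ofAdd (map_zero _)

theorem Source.reduce_inr_surjective :
    Function.Surjective fun v : Fin (r - 1) → ℤ_[p] => Source.reduce (N := N) (Source.inr v) := by
  intro a
  choose v hv using fun i => ZMod.ringHom_surjective (PadicInt.toZModPow (p := p) N)
    (Multiplicative.toAdd (a i))
  exact ⟨v, funext fun i => congrArg Multiplicative.ofAdd (hv i)⟩

theorem Source.exists_eq_nsmul {v w : Fin (r - 1) → ℤ_[p]}
    (h : Source.reduce (N := N) (Source.inr v) = Source.reduce (Source.inr w)) :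
    ∃ u, v = w + p ^ N • u := by
  have key : ∀ i, ∃ u, v i = w i + p ^ N • u := by
    intro i
    have hi : PadicInt.toZModPow N (v i) = PadicInt.toZModPow N (w i) := congrFun h i
    rw [← sub_eq_zero, ← map_sub, ← RingHom.mem_ker, PadicInt.ker_toZModPow,
      Ideal.mem_span_singleton'] at hi
    obtain ⟨u, hu⟩ := hi
    refine ⟨u, ?_⟩
    rw [nsmul_eq_mul]
    push_cast
    linear_combination -hu
  choose u hu using key
  exact ⟨u, funext hu⟩

/-- The homomorphism from `ℤ × ℤ_p ^ (r - 1)` assembled from a homomorphism from a finite quotient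
of the second factor and a commuting element. -/
noncomputable def homOfCommute {ρ : FiniteQuotient p N (r - 1) →* G} {g : G}
    (hg : ∀ a, Commute g (ρ a)) : Source p r →* G where
  toFun x := g ^ (Multiplicative.toAdd x).1 * ρ (Source.reduce x)
  map_one' := by simp
  map_mul' x y := by
    rw [toAdd_mul, Prod.fst_add, zpow_add, map_mul, map_mul]
    have := ((hg (Source.reduce x)).zpow_left (Multiplicative.toAdd y).1).eq
    simp only [mul_assoc]
    rw [← mul_assoc (ρ _) (g ^ _), ← this, mul_assoc]

theorem homOfCommute_gen {ρ : FiniteQuotient p N (r - 1) →* G} {g : G}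
    (hg : ∀ a, Commute g (ρ a)) : homOfCommute hg Source.gen = g := by
  change g ^ (1 : ℤ) * ρ (Source.reduce Source.gen) = g
  rw [Source.reduce_gen, zpow_one, map_one, mul_one]

theorem homOfCommute_inr {ρ : FiniteQuotient p N (r - 1) →* G} {g : G}
    (hg : ∀ a, Commute g (ρ a)) (v : Fin (r - 1) → ℤ_[p]) :
    homOfCommute hg (Source.inr v) = ρ (Source.reduce (Source.inr v)) := by
  change g ^ (0 : ℤ) * ρ (Source.reduce (Source.inr v)) = _
  rw [zpow_zero, one_mul]

theorem range_homOfCommute {ρ : FiniteQuotient p N (r - 1) →* G} {g : G}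
    (hg : ∀ a, Commute g (ρ a)) :
    (homOfCommute hg).range = Subgroup.closure (insert g (Set.range ρ)) := by
  apply le_antisymm
  · rintro _ ⟨x, rfl⟩
    have hg' : g ∈ Subgroup.closure (insert g (Set.range ρ)) :=
      Subgroup.subset_closure (Or.inl rfl)
    exact mul_mem (zpow_mem hg' _) (Subgroup.subset_closure (Or.inr ⟨_, rfl⟩))
  · rw [Subgroup.closure_le]
    rintro _ (rfl | ⟨a, rfl⟩)
    · exact ⟨Source.gen, homOfCommute_gen hg⟩
    · obtain ⟨v, rfl⟩ := Source.reduce_inr_surjective a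
      exact ⟨Source.inr v, homOfCommute_inr hg v⟩

theorem homOfCommute_injective : Function.Injective
    (fun x : (Σ ρ : FiniteQuotient p N (r - 1) →* G, {g : G // ∀ a, Commute g (ρ a)}) =>
      homOfCommute x.2.2) := by
  rintro ⟨ρ, g, hg⟩ ⟨ρ', g', hg'⟩ h
  have h' : homOfCommute hg = homOfCommute hg' := h
  have hρ : ρ = ρ' := by
    ext1 a
    obtain ⟨v, rfl⟩ := Source.reduce_inr_surjective a
    change ρ (Source.reduce (Source.inr v)) = ρ' (Source.reduce (Source.inr v))
    rw [← homOfCommute_inr hg, ← homOfCommute_inr hg', h']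
  subst hρ
  have hgg : g = g' := by rw [← homOfCommute_gen hg, h', homOfCommute_gen hg']
  subst hgg
  rfl

theorem exists_homOfCommute_eq (X : Source p r →* G)
    (hX : ∀ v, X (Source.inr (p ^ N • v)) = 1) :
    ∃ (ρ : FiniteQuotient p N (r - 1) →* G) (g : {g : G // ∀ a, Commute g (ρ a)}),
      homOfCommute g.2 = X := by
  have hwd : ∀ v w : Fin (r - 1) → ℤ_[p], Source.reduce (N := N) (Source.inr v) =
      Source.reduce (Source.inr w) → X (Source.inr v) = X (Source.inr w) := by
    intro v w h
    obtain ⟨u, rfl⟩ := Source.exists_eq_nsmul h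
    rw [Source.inr_add, map_mul, hX, mul_one]
  choose σ hσ using Source.reduce_inr_surjective (p := p) (r := r) (N := N)
  have hσ' : ∀ a, Source.reduce (Source.inr (σ a)) = a := hσ
  let ρ : FiniteQuotient p N (r - 1) →* G := MonoidHom.mk' (fun a => X (Source.inr (σ a)))
    fun a b => by
      rw [← map_mul, ← Source.inr_add]
      apply hwd
      rw [Source.inr_add, map_mul, hσ', hσ', hσ']
  have hg : ∀ a, Commute (X Source.gen) (ρ a) := fun a =>
    (Commute.all (Source.gen : Source p r) (Source.inr (σ a))).map X
  refine ⟨ρ, ⟨X Source.gen, hg⟩, ?_⟩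
  refine MonoidHom.ext fun x => ?_
  conv_rhs => rw [Source.eq_gen_zpow_mul_inr x, map_mul, map_zpow]
  conv_lhs => rw [Source.eq_gen_zpow_mul_inr x, map_mul, map_zpow, homOfCommute_gen,
    homOfCommute_inr]
  congr 1
  exact hwd _ _ (hσ' _)

/-- The prime-to-`p` part of $|G|$ is a unit of $\mathbf Z_p$, so $p^Nv$ is a multiple of $|G|$ in
$\mathbf Z_p^{r-1}$. -/
theorem map_inr_nsmul_eq_one [Finite G] (X : Source p r →* G)
    (hN : (Nat.card G).factorization p ≤ N) (v : Fin (r - 1) → ℤ_[p]) :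
    X (Source.inr (p ^ N • v)) = 1 := by
  have hp : p.Prime := Fact.out
  have hG : Nat.card G ≠ 0 := Nat.card_pos.ne'
  have hm : IsUnit ((ordCompl[p] (Nat.card G) : ℕ) : ℤ_[p]) := by
    rw [PadicInt.isUnit_iff, PadicInt.norm_natCast_eq_one_iff]
    exact Nat.coprime_ordCompl hp hG
  obtain ⟨u, hu⟩ := hm
  have hv : v = (ordCompl[p] (Nat.card G)) • ((u⁻¹ : ℤ_[p]ˣ) : ℤ_[p]) • v := by
    funext i
    rw [Pi.smul_apply, Pi.smul_apply, nsmul_eq_mul, ← hu, smul_eq_mul, Units.mul_inv_cancel_left]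
  obtain ⟨k, rfl⟩ := Nat.exists_eq_add_of_le hN
  rw [hv, smul_smul, pow_add, mul_right_comm, Nat.ordProj_mul_ordCompl_eq_self, mul_smul,
    Source.inr_nsmul, map_pow, pow_card_eq_one']

end Source

/-! ### Reduction of the Euler characteristic to a finite level -/

section Sum

variable {p : ℕ} [Fact p.Prime] {F : Type*} [Field F] {r n N : ℕ}

instance : Finite (FiniteQuotient p N r) :=
  have : NeZero (p ^ N) := ⟨pow_ne_zero _ (Fact.out : p.Prime).ne_zero⟩
  Pi.finite

/-- The finite level `N` is large enough to see all homomorphisms that contribute to the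
`p`-primary equivariant reduced Euler characteristic in degree `n`. -/
def IsLargeLevel (p : ℕ) (F : Type*) [Field F] (N n : ℕ) : Prop :=
  (CharP F p ∧ N = 0) ∨ (¬ CharP F p ∧ (Nat.card (GL (Fin n) F)).factorization p ≤ N)

/-- The Maschke condition: in characteristic `p` the quotient has level $0$ and is trivial;
otherwise its order is a power of the invertible element `p`. -/
theorem IsLargeLevel.neZero_natCard (hN : IsLargeLevel p F N n) (s : ℕ) :
    NeZero (Nat.card (FiniteQuotient p N s) : F) := by
  have hcard : Nat.card (FiniteQuotient p N s) = (p ^ N) ^ s := by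
    simp
  rw [hcard]
  refine ⟨?_⟩
  rcases hN with ⟨_, rfl⟩ | ⟨hp, _⟩
  · simp
  · push_cast
    refine pow_ne_zero _ (pow_ne_zero _ fun h => hp ?_)
    exact (CharP.charP_iff_prime_eq_zero Fact.out).2 h

variable [Finite F]

/-- The image of $\mathbf Z_p^{r-1}$ is a central `p`-subgroup of the range, nontrivial by
assumption. -/
theorem reducedEulerChar_eq_zero_of_map_inr_ne_one [NeZero n] [CharP F p]
    {X : Source p r →* GL (Fin n) F} {v : Fin (r - 1) → ℤ_[p]} (hv : X (Source.inr v) ≠ 1) :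
    reducedEulerChar (FixedSubspace X.range) = 0 := by
  let ι : Multiplicative (Fin (r - 1) → ℤ_[p]) →* Source p r :=
    AddMonoidHom.toMultiplicative (AddMonoidHom.inr ℤ (Fin (r - 1) → ℤ_[p]))
  refine reducedEulerChar_fixedSubspace_eq_zero p (Q := (X.comp ι).range) ?_ ?_ ?_ ?_
  · rintro _ ⟨w, rfl⟩
    exact ⟨_, rfl⟩
  · rintro _ ⟨x, rfl⟩ _ ⟨w, rfl⟩
    exact (Commute.all x (ι w)).map X
  · rintro ⟨_, w, rfl⟩
    refine ⟨(Nat.card (GL (Fin n) F)).factorization p, Subtype.ext ?_⟩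
    have h : X (Source.inr _) = 1 := map_inr_nsmul_eq_one X le_rfl (Multiplicative.toAdd w)
    rw [Source.inr_nsmul, map_pow] at h
    exact h
  · intro h
    have : X (Source.inr v) ∈ (X.comp ι).range := ⟨.ofAdd v, rfl⟩
    rw [h, Subgroup.mem_bot] at this
    exact hv this

theorem finsum_reducedEulerChar_eq_sum [NeZero n] (hN : IsLargeLevel p F N n)
    [Fintype (FiniteQuotient p N (r - 1) →* GL (Fin n) F)]
    [∀ ρ : FiniteQuotient p N (r - 1) →* GL (Fin n) F,
      Fintype {g : GL (Fin n) F // ∀ a, Commute g (ρ a)}] :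
    ∑ᶠ X : Source p r →* GL (Fin n) F, (reducedEulerChar (FixedSubspace X.range) : ℚ) =
      ∑ ρ : FiniteQuotient p N (r - 1) →* GL (Fin n) F,
        ∑ g : {g : GL (Fin n) F // ∀ a, Commute g (ρ a)},
          (mobius (RepModule.endOfCommute g.2) : ℚ) := by
  have : Fintype (Source p r →* GL (Fin n) F) := Fintype.ofFinite _
  rw [finsum_eq_sum_of_fintype, ← Fintype.sum_sigma'
    (fun (ρ : FiniteQuotient p N (r - 1) →* GL (Fin n) F)
      (g : {g : GL (Fin n) F // ∀ a, Commute g (ρ a)}) =>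
        (mobius (RepModule.endOfCommute g.2) : ℚ))]
  symm
  refine Fintype.sum_of_injective _ homOfCommute_injective _ _ (fun X hX => ?_) fun x => ?_
  · have hX' : ∃ v, X (Source.inr (p ^ N • v)) ≠ 1 := by
      by_contra! h
      obtain ⟨ρ, g, hg⟩ := exists_homOfCommute_eq X h
      exact hX ⟨⟨ρ, g⟩, hg⟩
    obtain ⟨v, hv⟩ := hX'
    -- Homomorphisms that miss the finite level contribute $0$ in characteristic `p`, and do not
    -- exist otherwise.
    rcases hN with ⟨_, rfl⟩ | ⟨_, hN⟩
    · rw [reducedEulerChar_eq_zero_of_map_inr_ne_one hv, Int.cast_zero]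
    · exact absurd (map_inr_nsmul_eq_one X hN v) hv
  · rw [reducedEulerChar_fixedSubspace x.2.2 (range_homOfCommute x.2.2)]

theorem primaryEulerChar_eq_sum [NeZero n] (hN : IsLargeLevel p F N n)
    [Fintype (MaximalSpectrum (MonoidAlgebra F (FiniteQuotient p N (r - 1))))]
    [DecidableEq (MaximalSpectrum (MonoidAlgebra F (FiniteQuotient p N (r - 1))))] :
    primaryEulerChar p F r n =
      ∑ t ∈ (Fintype.piFinset
        fun _ : MaximalSpectrum (MonoidAlgebra F (FiniteQuotient p N (r - 1))) =>
          Finset.range (n + 1)).filter (fun t => stdDim t = n), ∏ i, (chainMobius (t i) : ℚ) := by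
  classical
  have := hN.neZero_natCard (r - 1)
  have : Fintype (FiniteQuotient p N (r - 1) →* GL (Fin n) F) := Fintype.ofFinite _
  have : ∀ ρ : FiniteQuotient p N (r - 1) →* GL (Fin n) F,
      Fintype {g : GL (Fin n) F // ∀ a, Commute g (ρ a)} := fun _ => Fintype.ofFinite _
  rw [primaryEulerChar, finsum_reducedEulerChar_eq_sum hN, sum_mobius_rep, inv_mul_cancel_left₀]
  exact Nat.cast_ne_zero.2 Nat.card_pos.ne'

end Sum

/-! ### Residue degrees and characters -/

section Count

theorem card_monoidHom_zmod (M : ℕ) (C : Type*) [CommGroup C] [IsCyclic C] [Finite C] :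
    Nat.card (Multiplicative (ZMod M) →* C) = (Nat.card C).gcd M := by
  rw [← IsCyclic.card_powMonoidHom_ker]
  refine Nat.card_congr (Equiv.ofBijective (fun f => ⟨f (.ofAdd 1), ?_⟩) ⟨?_, ?_⟩)
  · rw [MonoidHom.mem_ker, powMonoidHom_apply, ← map_pow, ← ofAdd_nsmul]
    simp
  · intro f g h
    have h' : f (.ofAdd 1) = g (.ofAdd 1) := congrArg Subtype.val h
    refine MonoidHom.ext fun x => ?_
    obtain ⟨z, hz⟩ := ZMod.intCast_surjective (Multiplicative.toAdd x)
    have hx : x = (.ofAdd 1 : Multiplicative (ZMod M)) ^ z := by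
      rw [← ofAdd_zsmul, zsmul_one, hz, ofAdd_toAdd]
    rw [hx, map_zpow, map_zpow, h']
  · rintro ⟨u, hu⟩
    have hu' : u ^ M = 1 := hu
    let f : ZMod M →+ Additive C := ZMod.lift M ⟨zmultiplesHom _ (.ofMul u), by
      rw [zmultiplesHom_apply, natCast_zsmul, ← ofMul_pow, hu', ofMul_one]⟩
    refine ⟨AddMonoidHom.toMultiplicativeLeft f, Subtype.ext ?_⟩
    have hf : f ((1 : ℤ) : ZMod M) = Additive.ofMul u := by
      rw [ZMod.lift_coe]
      simp
    rw [Int.cast_one] at hf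
    exact congrArg Additive.toMul hf

theorem card_monoidHom_finiteQuotient (p N s : ℕ) (C : Type*) [CommGroup C] [IsCyclic C]
    [Finite C] : Nat.card (FiniteQuotient p N s →* C) = ((Nat.card C).gcd (p ^ N)) ^ s := by
  rw [← Nat.card_congr MonoidHom.noncommPiCoprodEquiv, Nat.card_congr (Equiv.subtypeUnivEquiv _),
    Nat.card_pi]
  · simp [card_monoidHom_zmod]
  · exact fun φ i j _ x y => Commute.all _ _

theorem gcd_prime_pow_eq_pPart {p m N : ℕ} (hp : p.Prime) (hm : m ≠ 0)
    (hN : padicValNat p m ≤ N) : m.gcd (p ^ N) = pPart p m := by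
  have : Fact p.Prime := ⟨hp⟩
  refine Nat.dvd_antisymm ?_ (Nat.dvd_gcd pow_padicValNat_dvd (pow_dvd_pow p hN))
  obtain ⟨k, _, hk⟩ := (Nat.dvd_prime_pow hp).1 (Nat.gcd_dvd_right m (p ^ N))
  rw [hk, pPart]
  exact pow_dvd_pow p ((padicValNat_dvd_iff_le hm).1 (hk ▸ Nat.gcd_dvd_left m (p ^ N)))

variable {F : Type*} [Field F]

/-- A homomorphism from an Artinian algebra to a field factors through a unique residue field. -/
theorem card_algHom_eq_sum (R : Type*) [CommRing R] [Algebra F R] [Finite R]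
    [Fintype (MaximalSpectrum R)] (K : Type*) [Field K] [Algebra F K] [Finite K] :
    Nat.card (R →ₐ[F] K) = ∑ i : MaximalSpectrum R, Nat.card ((R ⧸ i.asIdeal) →ₐ[F] K) := by
  have : ∀ i : MaximalSpectrum R, Finite ((R ⧸ i.asIdeal) →ₐ[F] K) := fun i => DFunLike.finite _
  rw [← Nat.card_sigma]
  symm
  refine Nat.card_congr (Equiv.ofBijective
    (fun x : (Σ i : MaximalSpectrum R, (R ⧸ i.asIdeal) →ₐ[F] K) =>
      x.2.comp (Ideal.Quotient.mkₐ F x.1.asIdeal)) ⟨?_, ?_⟩)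
  · have hker : ∀ x : (Σ i : MaximalSpectrum R, (R ⧸ i.asIdeal) →ₐ[F] K),
        RingHom.ker (x.2.comp (Ideal.Quotient.mkₐ F x.1.asIdeal)) = x.1.asIdeal := by
      rintro ⟨i, f⟩
      let _ := Ideal.Quotient.field i.asIdeal
      have hf : Function.Injective f := f.toRingHom.injective
      ext a
      rw [RingHom.mem_ker, AlgHom.comp_apply, map_eq_zero_iff f hf,
        Ideal.Quotient.mkₐ_eq_mk, Ideal.Quotient.eq_zero_iff_mem]
    rintro ⟨i, f⟩ ⟨j, g⟩ h
    have h' : f.comp (Ideal.Quotient.mkₐ F i.asIdeal) =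
      g.comp (Ideal.Quotient.mkₐ F j.asIdeal) := h
    have hij : i = j := MaximalSpectrum.ext (by
      rw [← hker ⟨i, f⟩, ← hker ⟨j, g⟩]
      exact congrArg RingHom.ker h')
    subst hij
    congr 1
    refine AlgHom.ext fun a => ?_
    obtain ⟨b, rfl⟩ := Ideal.Quotient.mk_surjective a
    exact congrArg (fun φ : R →ₐ[F] K => φ b) h'
  · intro f
    have hprime : (RingHom.ker f).IsPrime := RingHom.ker_isPrime _
    have hmax : (RingHom.ker f).IsMaximal := hprime.isMaximal'
    exact ⟨⟨⟨RingHom.ker f, hmax⟩, Ideal.kerLiftAlg f⟩, AlgHom.ext fun _ => rfl⟩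

/-- The character count: residue degrees of the group algebra of `(ℤ / p ^ N) ^ s`. -/
theorem sum_finrank_quotient [Finite F] {p N s k : ℕ} [Fact p.Prime] (hk : k ≠ 0)
    (hN : (CharP F p ∧ N = 0) ∨ padicValNat p (Nat.card F ^ k - 1) ≤ N)
    [Fintype (MaximalSpectrum (MonoidAlgebra F (FiniteQuotient p N s)))] :
    (∑ i : MaximalSpectrum (MonoidAlgebra F (FiniteQuotient p N s)),
      if Module.finrank F (MonoidAlgebra F (FiniteQuotient p N s) ⧸ i.asIdeal) ∣ k then
        Module.finrank F (MonoidAlgebra F (FiniteQuotient p N s) ⧸ i.asIdeal) else 0) =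
      pPart p (Nat.card F ^ k - 1) ^ s := by
  have hp : p.Prime := Fact.out
  have : NeZero k := ⟨hk⟩
  have hc : CharP F (ringChar F) := inferInstance
  have : Fact (ringChar F).Prime := ⟨CharP.char_is_prime F _⟩
  let K := FiniteField.Extension F (ringChar F) k
  have hcardK : Nat.card Kˣ = Nat.card F ^ k - 1 := by
    rw [Nat.card_units, FiniteField.natCard_extension]
  have hfin : Module.finrank F K = k := FiniteField.finrank_extension F (ringChar F) k
  have hpos : Nat.card F ^ k - 1 ≠ 0 := by
    have : 1 < Nat.card F ^ k := Nat.one_lt_pow hk Finite.one_lt_card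
    omega
  -- In characteristic `p` both sides are $1$, since `p` divides $q^k$ and hence not $q^k-1$.
  have hgcd : (Nat.card F ^ k - 1).gcd (p ^ N) = pPart p (Nat.card F ^ k - 1) := by
    rcases hN with ⟨hF, rfl⟩ | hN
    · have hq : p ∣ Nat.card F ^ k := dvd_pow ((CharP.cast_eq_zero_iff F p _).1 (by
        have := Fintype.ofFinite F
        rw [Nat.card_eq_fintype_card]
        exact FiniteField.cast_card_eq_zero F)) hk
      have hndvd : ¬ p ∣ Nat.card F ^ k - 1 := by
        intro h
        have h1 := (Nat.dvd_sub_iff_right (by omega) hq).1 h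
        exact hp.one_lt.ne' (Nat.dvd_one.1 h1)
      rw [pPart, padicValNat.eq_zero_of_not_dvd hndvd]
      simp
    · exact gcd_prime_pow_eq_pPart hp hpos hN
  have hcount : Nat.card (MonoidAlgebra F (FiniteQuotient p N s) →ₐ[F] K) =
      pPart p (Nat.card F ^ k - 1) ^ s := by
    rw [← hgcd, ← hcardK, ← card_monoidHom_finiteQuotient,
      ← Nat.card_congr (MonoidAlgebra.lift F K (FiniteQuotient p N s))]
    exact Nat.card_congr
      { toFun := fun f => f.toHomUnits
        invFun := fun f => (Units.coeHom K).comp f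
        left_inv := fun f => MonoidHom.ext fun _ => rfl
        right_inv := fun f => MonoidHom.ext fun _ => Units.ext rfl }
  rw [← hcount, card_algHom_eq_sum]
  refine Finset.sum_congr rfl fun i _ => ?_
  let _ := Ideal.Quotient.field i.asIdeal
  -- A residue field of degree $d$ has $d$ embeddings over `F` into the extension of degree `k` if
  -- $d\mid k$, and none otherwise.
  split_ifs with h
  · exact (FiniteField.natCard_algHom_of_finrank_dvd (h.trans hfin.symm.dvd)).symm
  · have : IsEmpty ((MonoidAlgebra F (FiniteQuotient p N s) ⧸ i.asIdeal) →ₐ[F] K) := by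
      rw [← not_nonempty_iff, FiniteField.nonempty_algHom_iff_finrank_dvd, hfin]
      exact h
    simp

end Count

/-! ### Power series with prescribed logarithmic derivative -/

section Series

open PowerSeries

theorem coeff_prod_one_sub_X_pow {ι : Type*} [Fintype ι] [DecidableEq ι] (d : ι → ℕ) {n : ℕ}
    (hn : n ≠ 0) :
    coeff n (∏ i, (1 - X ^ d i : PowerSeries ℚ)) =
      ∑ t ∈ (Fintype.piFinset fun _ : ι => Finset.range (n + 1)).filter
        (fun t => ∑ i, t i * d i = n), ∏ i, (chainMobius (t i) : ℚ) := by
  have h1 : ∀ i, (1 - X ^ d i : PowerSeries ℚ) =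
      ∑ j ∈ Finset.range (n + 1), C (chainMobius j : ℚ) * X ^ (j * d i) := by
    intro i
    -- `chainMobius` is supported on $\{0,1\}$, and `n ≠ 0` keeps the index $1$ in the truncated
    -- range.
    have hsub : Finset.range 2 ⊆ Finset.range (n + 1) :=
      Finset.range_subset_range.2 (by omega)
    rw [← Finset.sum_subset hsub, Finset.sum_range_succ, Finset.sum_range_one]
    · simp [chainMobius, sub_eq_add_neg]
    · intro j _ hj
      obtain ⟨k, rfl⟩ : ∃ k, j = k + 2 := ⟨j - 2, by
        rw [Finset.mem_range] at hj
        omega⟩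
      simp [chainMobius]
  rw [Finset.prod_congr rfl fun i _ => h1 i, Finset.prod_univ_sum, map_sum, Finset.sum_filter]
  refine Finset.sum_congr rfl fun t _ => ?_
  rw [Finset.prod_mul_distrib, Finset.prod_pow_eq_pow_sum, ← map_prod, coeff_C_mul_X_pow]
  simp only [eq_comm]

/-- The series `∑_{k ≥ 1} a k x ^ k`. -/
noncomputable def positiveSeries (a : ℕ → ℚ) : PowerSeries ℚ :=
  mk fun k => if k = 0 then 0 else a k

/-- Both sides are $-dX^d$: the series $\sum_{k\ge1,\,d\mid k}dX^k$ telescopes against $1-X^d$. -/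
theorem X_mul_derivative_one_sub_X_pow {d : ℕ} (hd : 0 < d) :
    X * d⁄dX ℚ (1 - X ^ d : PowerSeries ℚ) =
      -positiveSeries (fun k => if d ∣ k then (d : ℚ) else 0) * (1 - X ^ d) := by
  have h1 : X * d⁄dX ℚ (1 - X ^ d : PowerSeries ℚ) = -((d : PowerSeries ℚ) * X ^ d) := by
    obtain ⟨e, rfl⟩ := Nat.exists_eq_succ_of_ne_zero hd.ne'
    rw [map_sub, derivative_pow]
    simp
    ring
  rw [h1, neg_mul, neg_inj]
  ext k
  rw [← map_natCast (C (R := ℚ)), coeff_C_mul_X_pow, mul_sub, mul_one, map_sub, coeff_mul_X_pow',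
    positiveSeries, coeff_mk, coeff_mk]
  rcases lt_trichotomy k d with h | h | h
  · rw [if_neg h.ne, if_neg h.not_ge, sub_zero]
    by_cases h0 : k = 0
    · rw [if_pos h0]
    · rw [if_neg h0, if_neg (Nat.not_dvd_of_pos_of_lt (Nat.pos_of_ne_zero h0) h)]
  · subst h
    simp [hd.ne']
  · have h2 : d ∣ k - d ↔ d ∣ k := (Nat.dvd_sub_iff_left h.le dvd_rfl)
    have h3 : k ≠ 0 := by omega
    have h4 : k - d ≠ 0 := by omega
    rw [if_neg h.ne', if_pos h.le, if_neg h3, if_neg h4]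
    simp [h2]

theorem X_mul_derivative_prod {ι : Type*} (S : Finset ι) (d : ι → ℕ) (hd : ∀ i, 0 < d i) :
    X * d⁄dX ℚ (∏ i ∈ S, (1 - X ^ d i : PowerSeries ℚ)) =
      -positiveSeries (fun k => ∑ i ∈ S, if d i ∣ k then (d i : ℚ) else 0) *
        ∏ i ∈ S, (1 - X ^ d i) := by
  classical
  induction S using Finset.induction_on with
  | empty =>
    have : positiveSeries (fun _ => (0 : ℚ)) = 0 := by
      ext k
      simp [positiveSeries]
    simp [this]
  | insert i S hi ih =>
    have hadd : positiveSeries (fun k => ∑ j ∈ insert i S, if d j ∣ k then (d j : ℚ) else 0) =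
        positiveSeries (fun k => if d i ∣ k then (d i : ℚ) else 0) +
          positiveSeries (fun k => ∑ j ∈ S, if d j ∣ k then (d j : ℚ) else 0) := by
      ext k
      simp only [positiveSeries, coeff_mk, map_add, Finset.sum_insert hi]
      split_ifs <;> simp
    rw [Finset.prod_insert hi, Derivation.leibniz, hadd]
    have h1 := X_mul_derivative_one_sub_X_pow (hd i)
    simp only [smul_eq_mul]
    linear_combination (1 - X ^ d i) * ih + (∏ j ∈ S, (1 - X ^ d j)) * h1

/-- The differential equation says $nf_n=-\sum_{k=1}^n a_kf_{n-k}$, so $f_n$ depends only on $f_0$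
and $a_1,\dots,a_n$. This allows comparison with a product whose exponents are controlled only up to
degree `n`. -/
theorem coeff_eq_of_logDerivative {f g : PowerSeries ℚ} {a b : ℕ → ℚ}
    (hf : X * d⁄dX ℚ f = -positiveSeries a * f) (hg : X * d⁄dX ℚ g = -positiveSeries b * g)
    (h0 : coeff 0 f = coeff 0 g) {n : ℕ} (hab : ∀ k, k ≠ 0 → k ≤ n → a k = b k) :
    coeff n f = coeff n g := by
  induction n using Nat.strong_induction_on with
  | _ n ih =>
  rcases n with _ | m
  · exact h0
  · have key : ∀ {f : PowerSeries ℚ} {a : ℕ → ℚ}, X * d⁄dX ℚ f = -positiveSeries a * f →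
        coeff (m + 1) f * (m + 1) = -∑ x ∈ Finset.HasAntidiagonal.antidiagonal (m + 1),
          (if x.1 = 0 then 0 else a x.1) * coeff x.2 f := by
      intro f a h
      have h' := congrArg (coeff (m + 1)) h
      rw [coeff_succ_X_mul, coeff_derivative, neg_mul, map_neg, coeff_mul] at h'
      simpa [positiveSeries] using h'
    have hm : ((m : ℚ) + 1) ≠ 0 := by positivity
    refine mul_right_cancel₀ hm ?_
    rw [key hf, key hg]
    congr 1
    refine Finset.sum_congr rfl fun x hx => ?_
    rw [Finset.HasAntidiagonal.mem_antidiagonal] at hx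
    split_ifs with hx0
    · simp
    · rw [hab _ hx0 (by omega), ih _ (by omega) fun k hk hk' => hab k hk (by omega)]

theorem X_mul_derivative_exp_subst (a : ℕ → ℚ) :
    X * d⁄dX ℚ ((exp ℚ).subst (-positiveSeries fun k => a k / k)) =
      -positiveSeries a * (exp ℚ).subst (-positiveSeries fun k => a k / k) := by
  have hs : HasSubst (-positiveSeries fun k => a k / k) :=
    HasSubst.of_constantCoeff_zero' (by
      rw [← coeff_zero_eq_constantCoeff_apply]
      simp [positiveSeries])
  have hX : X * d⁄dX ℚ (positiveSeries fun k => a k / k) = positiveSeries a := by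
    ext k
    rcases k with _ | k
    · simp [positiveSeries]
    · rw [coeff_succ_X_mul, coeff_derivative, positiveSeries, positiveSeries, coeff_mk, coeff_mk,
        if_neg (by omega), if_neg (by omega)]
      push_cast
      field_simp
  rw [derivative_subst hs, derivative_exp, map_neg, ← hX]
  ring

theorem coeff_zero_exp_subst (a : ℕ → ℚ) :
    coeff 0 ((exp ℚ).subst (-positiveSeries a)) = 1 := by
  have h0 : constantCoeff (-positiveSeries a) = 0 := by
    rw [← coeff_zero_eq_constantCoeff_apply]
    simp [positiveSeries]
  have hs : HasSubst (-positiveSeries a) := HasSubst.of_constantCoeff_zero' h0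
  rw [coeff_subst' hs, finsum_eq_single _ 0]
  · simp
  · intro d hd
    simp [h0, hd]

end Series

/-! ### Choice of the level and comparison of coefficients -/

section Main

variable (p : ℕ) (F : Type*) [Field F]

/-- One level has to serve two purposes: to see all contributing homomorphisms into $\mathrm{GL}_n$,
and to see the full `p`-parts of $q^k-1$ for $k\le n$. -/
theorem exists_isLargeLevel (n : ℕ) : ∃ N, IsLargeLevel p F N n ∧ ∀ k ≤ n,
    (CharP F p ∧ N = 0) ∨ padicValNat p (Nat.card F ^ k - 1) ≤ N := by
  by_cases hF : CharP F p
  · exact ⟨0, Or.inl ⟨hF, rfl⟩, fun _ _ => Or.inl ⟨hF, rfl⟩⟩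
  · refine ⟨(Nat.card (GL (Fin n) F)).factorization p +
      ∑ k ∈ Finset.range (n + 1), padicValNat p (Nat.card F ^ k - 1),
      Or.inr ⟨hF, Nat.le_add_right _ _⟩, fun k hk => Or.inr ?_⟩
    refine le_trans ?_ (Nat.le_add_left _ _)
    exact Finset.single_le_sum (f := fun k => padicValNat p (Nat.card F ^ k - 1))
      (fun _ _ => Nat.zero_le _) (Finset.mem_range.2 (Nat.lt_succ_of_le hk))

variable [Fact p.Prime] [Finite F]

theorem exists_int_eq_primaryEulerChar (r : ℕ) {n : ℕ} (hn : n ≠ 0) :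
    ∃ z : ℤ, (z : ℚ) = primaryEulerChar p F r n := by
  have : NeZero n := ⟨hn⟩
  obtain ⟨N, hN, _⟩ := exists_isLargeLevel p F n
  have : Fintype (MaximalSpectrum (MonoidAlgebra F (FiniteQuotient p N (r - 1)))) :=
    Fintype.ofFinite _
  have : DecidableEq (MaximalSpectrum (MonoidAlgebra F (FiniteQuotient p N (r - 1)))) :=
    Classical.decEq _
  rw [primaryEulerChar_eq_sum (r := r) hN]
  exact ⟨∑ t ∈ (Fintype.piFinset
    fun _ : MaximalSpectrum (MonoidAlgebra F (FiniteQuotient p N (r - 1))) =>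
      Finset.range (n + 1)).filter (fun t => stdDim t = n),
      ∏ i, chainMobius (t i), by push_cast; rfl⟩

theorem primaryEulerChar_eq_coeff (r : ℕ) {n : ℕ} (hn : n ≠ 0) :
    primaryEulerChar p F r n = PowerSeries.coeff n
      ((PowerSeries.exp ℚ).subst (-primaryExponent p (Nat.card F) r)) := by
  have : NeZero n := ⟨hn⟩
  obtain ⟨N, hN, hN'⟩ := exists_isLargeLevel p F n
  have : Fintype (MaximalSpectrum (MonoidAlgebra F (FiniteQuotient p N (r - 1)))) :=
    Fintype.ofFinite _
  have : DecidableEq (MaximalSpectrum (MonoidAlgebra F (FiniteQuotient p N (r - 1)))) :=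
    Classical.decEq _
  have hE : primaryExponent p (Nat.card F) r =
      positiveSeries fun k => (pPart p (Nat.card F ^ k - 1) : ℚ) ^ (r - 1) / k := rfl
  rw [primaryEulerChar_eq_sum (r := r) hN, hE]
  -- The product runs over the simple modules of the group algebra at this level, with their
  -- dimensions over `F` as exponents.
  refine (coeff_prod_one_sub_X_pow (fun i : MaximalSpectrum (MonoidAlgebra F
    (FiniteQuotient p N (r - 1))) => Module.finrank F (_ ⧸ i.asIdeal)) hn).symm.trans ?_
  refine coeff_eq_of_logDerivative
    (X_mul_derivative_prod _ _ fun i => finrank_quotient_pos i)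
    (X_mul_derivative_exp_subst _) ?_ fun k hk hkn => ?_
  · rw [coeff_zero_exp_subst, PowerSeries.coeff_zero_eq_constantCoeff_apply, map_prod]
    exact Finset.prod_eq_one fun i _ => by simp [(finrank_quotient_pos i).ne']
  · rw [← Nat.cast_pow, ← sum_finrank_quotient hk (hN' k hkn)]
    push_cast
    rfl

end Main

end PPrimaryEuler

theorem theorem1p4 (p : ℕ) [Fact p.Prime] (q : ℕ) (F : Type*) [Field F] [Finite F]
    (hF : Nat.card F = q) (r : ℕ) (hr : 1 ≤ r) :
    (∃ f : PowerSeries ℤ,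
      PowerSeries.map (Int.castRingHom ℚ) f = PPrimaryEuler.primaryGenFun p F r) ∧
    PPrimaryEuler.primaryGenFun p F r =
      PowerSeries.subst (-PPrimaryEuler.primaryExponent p q r) (PowerSeries.exp ℚ) := by
  subst hF
  constructor
  · choose z hz using fun n : {n : ℕ // n ≠ 0} =>
      PPrimaryEuler.exists_int_eq_primaryEulerChar p F r n.2
    refine ⟨PowerSeries.mk fun n => if hn : n = 0 then 1 else z ⟨n, hn⟩, ?_⟩
    ext n
    rw [PowerSeries.coeff_map, PPrimaryEuler.primaryGenFun, PowerSeries.coeff_mk,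
      PowerSeries.coeff_mk]
    split_ifs with hn
    · simp
    · exact hz ⟨n, hn⟩
  · ext n
    rw [PPrimaryEuler.primaryGenFun, PowerSeries.coeff_mk]
    split_ifs with hn
    · subst hn
      exact (PPrimaryEuler.coeff_zero_exp_subst _).symm
    · exact PPrimaryEuler.primaryEulerChar_eq_coeff p F r hn
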